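/- Let $V$ be a separable real Hilbert space and let $A$ be a linear operator in $V$ such that $-A$ is strictly positive and symmetric with compact inverse; let $S$ be the strongly continuous (in fact analytic) semigroup generated by $A$, and let $(e_i)_i$ be a complete orthonormal basis of $V$ consisting of eigenvectors of $-A$. Let $F:V\to V$ be continuous with at most linear growth, $\|F(u)\|\le c_F+L_F\|u\|$, and let $G:V\to L_2(V)$ be Lipschitz continuous, where $L_2(V)$ is the space of Hilbert–Schmidt operators on $V$. Fix $1/2<\beta<\beta'<1$ and $1-\beta'<\alpha<\beta$. For $s<t$, a path $\omega$ in $V$ and an $L_2(V)$-valued function $g$ on $[s,t]$, the pathwise integral is $$\int_s^t g\,d\omega=(-1)^{\alpha}\sum_{j}\Big(\sum_{i}\int_s^t D^{\alpha}_{s+}(e_j,g(\cdot)e_i)[r]\;D^{1-\alpha}_{t-}(e_i,\omega(\cdot))_{t-}[r]\,dr\Big)e_j ,$$ where $$D^{\alpha}_{s+}f[r]=\frac1{\Gamma(1-\alpha)}\Big(\frac{f(r)}{(r-s)^{\alpha}}+\alpha\int_s^r\frac{f(r)-f(q)}{(r-q)^{1+\alpha}}dq\Big),$$ $$D^{1-\alpha}_{t-}f_{t-}[r]=\frac{(-1)^{1-\alpha}}{\Gamma(\alpha)}\Big(\frac{f(r)-f(t)}{(t-r)^{1-\alpha}}+(1-\alpha)\int_r^t\frac{f(r)-f(q)}{(q-r)^{2-\alpha}}dq\Big),$$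 and $(-1)^{\alpha}(-1)^{1-\alpha}=-1$. Let $C^{\beta}_{\beta}([0,T],V)$ be the space of continuous $u:[0,T]\to V$ with $$\sup_{0\le s\le T}\|u(s)\|+\sup_{0<s<t\le T}s^{\beta}\frac{\|u(t)-u(s)\|}{(t-s)^{\beta}}<\infty .$$ Let $\Omega=C^{0,\beta'}_0(\mathbb R,V)$ be the set of continuous $\omega:\mathbb R\to V$ with $\omega(0)=0$ whose restriction to each $[-n,n]$, $n\in\mathbb N$, lies in the closure of $C^{\infty}([-n,n],V)$ in the Hölder space $C^{\beta'}([-n,n],V)$. For $u_0\in V$ and $\omega\in\Omega$, a globally defined mild solution of $du=(Au+F(u))\,dt+G(u)\,d\omega$, $u(0)=u_0$, is a function $u:[0,\infty)\to V$ such that for every $T>0$ one has $u|_{[0,T]}\in C^{\beta}_{\beta}([0,T],V)$ and, for all $t\in[0,T]$, $$u(t)=S(t)u_0+\int_0^tS(t-r)F(u(r))\,dr+\int_0^tS(t-r)G(u(r))\,d\omega(r).$$ For $t\ge0$ let $$\Phi(t,\omega,u_0)=\{u(t): u\text{ is a globally defined mild solution with initial value }u_0\text{ and driving path }\omega\}\subset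 V .$$ Then for every fixed $t\ge0$ and $\omega\in\Omega$ the multivalued map $u_0\mapsto\Phi(t,\omega,u_0)$ is upper semicontinuous on $V$: for every $x_0\in V$ and every open set $\mathcal O\subset V$ with $\Phi(t,\omega,x_0)\subset\mathcal O$ there is $\delta>0$ such that $\Phi(t,\omega,y)\subset\mathcal O$ for all $y\in V$ with $\|x_0-y\|<\delta$. -/

import Mathlib

open Set Filter Topology MeasureTheory
open scoped ENNReal RealInnerProductSpace

noncomputable section

namespace FractionalEvolution

/-! ### Spaces of Hölder functions -/

section Holder

variable {V : Type*} [NormedAddCommGroup V] [NormedSpace ℝ V]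

/-- The Hölder norm `sup ‖u(s)‖ + sup ‖u(t) - u(s)‖ / (t - s) ^ β` on `[a, b]`, with value `∞` for
functions that are not bounded or not Hölder continuous. -/
def holderENorm (β a b : ℝ) (u : ℝ → V) : ℝ≥0∞ :=
  (⨆ s ∈ Icc a b, ‖u s‖ₑ) +
    ⨆ (s : ℝ) (t : ℝ) (_ : a ≤ s ∧ s < t ∧ t ≤ b),
      ENNReal.ofReal (‖u t - u s‖ / (t - s) ^ β)

/-- The weighted Hölder norm
`sup ‖u(s)‖ + sup (s - a) ^ β * ‖u(t) - u(s)‖ / (t - s) ^ β` on `[a, b]`. -/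
def weightedHolderENorm (β a b : ℝ) (u : ℝ → V) : ℝ≥0∞ :=
  (⨆ s ∈ Icc a b, ‖u s‖ₑ) +
    ⨆ (s : ℝ) (t : ℝ) (_ : a < s ∧ s < t ∧ t ≤ b),
      ENNReal.ofReal ((s - a) ^ β * (‖u t - u s‖ / (t - s) ^ β))

/-- `u|_[a, b]` belongs to the weighted space `C^β_β([a, b], V)`. -/
def MemWeightedHolder (β a b : ℝ) (u : ℝ → V) : Prop :=
  ContinuousOn u (Icc a b) ∧ weightedHolderENorm β a b u < ∞

/-- `u|_[a, b]` belongs to `C^{0, γ}([a, b], V)`, the closure of the smooth functions in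
`C^γ([a, b], V)`. -/
def MemLittleHolder (γ a b : ℝ) (u : ℝ → V) : Prop :=
  holderENorm γ a b u < ∞ ∧
    ∀ ε : ℝ≥0∞, 0 < ε → ∃ φ : ℝ → V,
      ContDiffOn ℝ ((⊤ : ℕ∞) : WithTop ℕ∞) φ (Icc a b) ∧ holderENorm γ a b (fun s => u s - φ s) < ε

variable (V) in
/-- The path space `C_0^{0, γ}(ℝ, V)`: the continuous paths that vanish at zero and whose
restriction to every interval `[-n, n]` belongs to `C^{0, γ}([-n, n], V)`. -/
def pathSpace (γ : ℝ) : Set (ℝ → V) :=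
  {ω | Continuous ω ∧ ω 0 = 0 ∧ ∀ n : ℕ, MemLittleHolder γ (-(n : ℝ)) n ω}

end Holder

/-! ### The operator and its semigroup -/

section Operator

variable {V : Type*} [NormedAddCommGroup V] [InnerProductSpace ℝ V]

/-- `-A` is a strictly positive symmetric operator with a compact inverse. -/
structure IsAdmissibleOperator (A : V →ₗ.[ℝ] V) : Prop where
  symmetric : (-A).IsFormalAdjoint (-A)
  strictlyPositive : ∀ x : (-A).domain, (x : V) ≠ 0 → 0 < ⟪(-A) x, (x : V)⟫
  compactInverse : ∃ K : V →L[ℝ] V, IsCompactOperator K ∧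
    (∀ y : V, (K y, y) ∈ (-A).graph) ∧ ∀ x : (-A).domain, K ((-A) x) = x

/-- `S` (on `[0, ∞)`) is the strongly continuous semigroup generated by `A`: the domain of `A` is
the set of `x` for which `(S(h) x - x) / h` converges as `h ↓ 0`, and `A x` is the limit. -/
structure IsSemigroupGeneratedBy (S : ℝ → V →L[ℝ] V) (A : V →ₗ.[ℝ] V) : Prop where
  map_zero : S 0 = ContinuousLinearMap.id ℝ V
  map_add : ∀ s t : ℝ, 0 ≤ s → 0 ≤ t → S (s + t) = (S s).comp (S t)
  strongly_continuous : ∀ x : V, ContinuousOn (fun t => S t x) (Ici 0)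
  generator : ∀ x y : V,
    (x, y) ∈ A.graph ↔ Tendsto (fun h : ℝ => h⁻¹ • (S h x - x)) (𝓝[>] 0) (𝓝 y)

/-- The orthonormal basis `e` consists of eigenvectors of `-A`. -/
def IsEigenbasis {ι : Type*} (A : V →ₗ.[ℝ] V) (e : HilbertBasis ι ℝ V) : Prop :=
  ∀ i, ∃ lam : ℝ, (e i, lam • e i) ∈ (-A).graph

/-- The Hilbert-Schmidt norm of `B` (the value does not depend on the orthonormal basis `e`);
`B` is a Hilbert-Schmidt operator iff it is finite. -/
def hilbertSchmidtENorm {ι : Type*} (e : HilbertBasis ι ℝ V) (B : V →L[ℝ] V) : ℝ≥0∞ :=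
  (∑' i, ‖B (e i)‖ₑ ^ 2) ^ (1 / 2 : ℝ)

/-- `G` takes values in the Hilbert-Schmidt operators and is Lipschitz continuous as a map into
the space of these operators. -/
def IsLipschitzHilbertSchmidt {ι : Type*} (e : HilbertBasis ι ℝ V) (G : V → V →L[ℝ] V) : Prop :=
  (∀ u, hilbertSchmidtENorm e (G u) < ∞) ∧
    ∃ L : ℝ, ∀ u v, hilbertSchmidtENorm e (G u - G v) ≤ ENNReal.ofReal (L * ‖u - v‖)

end Operator

/-! ### The pathwise integral -/

/-- The left-sided fractional derivative `D_{s+}^α f` at `r`. -/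
def leftFracDeriv (α s : ℝ) (f : ℝ → ℝ) (r : ℝ) : ℝ :=
  1 / Real.Gamma (1 - α) *
    (f r / (r - s) ^ α + α * ∫ q in s..r, (f r - f q) / (r - q) ^ (1 + α))

/-- The right-sided fractional derivative `D_{t-}^{1-α} f_{t-}` at `r` of `f_{t-} = f - f(t)`,
without its factor `(-1) ^ (1 - α)`. -/
def rightFracDeriv (α t : ℝ) (f : ℝ → ℝ) (r : ℝ) : ℝ :=
  1 / Real.Gamma α *
    ((f r - f t) / (t - r) ^ (1 - α) +
      (1 - α) * ∫ q in r..t, (f r - f q) / (q - r) ^ (2 - α))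

section Integral

variable {V : Type*} [NormedAddCommGroup V] [InnerProductSpace ℝ V]

/-- The pathwise integral `∫_s^t g dω`. The sign in front is the product of the factor
`(-1) ^ α` of the integral with the factor `(-1) ^ (1 - α)` of the right-sided fractional
derivative. -/
def pathwiseIntegral {ι : Type*} (e : HilbertBasis ι ℝ V) (α s t : ℝ)
    (g : ℝ → V →L[ℝ] V) (ω : ℝ → V) : V :=
  -∑' j, (∑' i, ∫ r in s..t,
      leftFracDeriv α s (fun q => ⟪e j, g q (e i)⟫) r *
        rightFracDeriv α t (fun q => ⟪e i, ω q⟫) r) • e j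

end Integral

/-! ### Mild solutions and the multivalued solution operator -/

section Solutions

variable {V : Type*} [NormedAddCommGroup V] [InnerProductSpace ℝ V]

/-- `u` is a mild pathwise solution on `[0, T]` of
`du = (A u + F(u)) dt + G(u) dω`, `u(0) = u₀`, where `S` is the semigroup generated by `A`. -/
def IsMildSolution {ι : Type*} (S : ℝ → V →L[ℝ] V) (e : HilbertBasis ι ℝ V)
    (F : V → V) (G : V → V →L[ℝ] V) (α β T : ℝ) (ω : ℝ → V) (u₀ : V) (u : ℝ → V) : Prop :=
  MemWeightedHolder β 0 T u ∧
    ∀ t ∈ Icc 0 T,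
      u t = S t u₀ + (∫ r in (0 : ℝ)..t, S (t - r) (F (u r))) +
        pathwiseIntegral e α 0 t (fun r => (S (t - r)).comp (G (u r))) ω

/-- The globally defined mild solutions with initial value `u₀` and driving path `ω` (only the
values on `[0, ∞)` matter). -/
def globalSolutions {ι : Type*} (S : ℝ → V →L[ℝ] V) (e : HilbertBasis ι ℝ V)
    (F : V → V) (G : V → V →L[ℝ] V) (α β : ℝ) (u₀ : V) (ω : ℝ → V) : Set (ℝ → V) :=
  {u | ∀ T : ℝ, 0 < T → IsMildSolution S e F G α β T ω u₀ u}

/-- The multivalued operator `Φ(t, ω, u₀)`: all values at time `t` of the globally defined mild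
solutions with initial value `u₀` and driving path `ω`. -/
def Phi {ι : Type*} (S : ℝ → V →L[ℝ] V) (e : HilbertBasis ι ℝ V)
    (F : V → V) (G : V → V →L[ℝ] V) (α β : ℝ) (t : ℝ) (ω : ℝ → V) (u₀ : V) : Set V :=
  {x | ∃ u ∈ globalSolutions S e F G α β u₀ ω, u t = x}

end Solutions

/-! ### Upper semicontinuity of multivalued maps -/

section Multivalued

variable {V : Type*} [NormedAddCommGroup V]

/-- Upper semicontinuity at `x₀` of the multivalued map `Ψ`. -/
def IsUpperSemicontinuousAt (Ψ : V → Set V) (x₀ : V) : Prop :=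
  ∀ O : Set V, IsOpen O → Ψ x₀ ⊆ O → ∃ δ > 0, ∀ y : V, ‖x₀ - y‖ < δ → Ψ y ⊆ O

/-- Upper semicontinuity of the multivalued map `Ψ`. -/
def IsUpperSemicontinuous (Ψ : V → Set V) : Prop :=
  ∀ x₀, IsUpperSemicontinuousAt Ψ x₀

/-- The notion agrees with upper hemicontinuity. -/
theorem isUpperSemicontinuous_iff (Ψ : V → Set V) :
    IsUpperSemicontinuous Ψ ↔ UpperHemicontinuous Ψ := by
  constructor
  · intro h x t ht
    obtain ⟨O, hO, hxO, hOt⟩ := mem_nhdsSet_iff_exists.1 ht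
    obtain ⟨δ, hδ, hy⟩ := h x O hO hxO
    filter_upwards [Metric.ball_mem_nhds x hδ] with y hyx
    refine mem_nhdsSet_iff_exists.2 ⟨O, hO, hy y ?_, hOt⟩
    rwa [Metric.mem_ball', dist_eq_norm] at hyx
  · intro h x O hO hxO
    have h1 : ∀ᶠ y in 𝓝 x, O ∈ 𝓝ˢ (Ψ y) := h x O (hO.mem_nhdsSet.2 hxO)
    obtain ⟨δ, hδ, hy⟩ := Metric.eventually_nhds_iff.1 h1
    refine ⟨δ, hδ, fun y hxy => hO.mem_nhdsSet.1 (hy ?_)⟩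
    rwa [dist_comm, dist_eq_norm]

end Multivalued

end FractionalEvolution

end

noncomputable section

namespace FractionalEvolution

set_option linter.unusedSectionVars false

/-! ### Scalar estimates -/

/-! The theorem is a compactness statement about solutions. If upper semicontinuity fails at `x₀`,
there are initial values `y n → x₀` and global solutions `u n` starting there with `u n t` outside
the open set `O`. A subsequence converges at every time to a global solution starting at `x₀`. Its
value at `t` lies in `O` by assumption, but also in the closed complement as a limit, a
contradiction. Uniqueness of solutions plays no role.

The pathwise integral is first made accessible to estimates. By `pathwiseIntegral_eq` the double
series is a Bochner integral over `r`: an operator-valued fractional derivative of `q ↦ S (t - q)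
G(u q)` applied to the vector-valued fractional derivative of `ω`. The semigroup enters only through
`SmoothingSemigroup`, whose properties are read off the multipliers `exp (-l t)` on the eigenbasis.

Next, `exists_mildIntegral_bounds` estimates the convolution in weighted Hölder norms with
exponential weight `exp (ρ t)` and gains a factor `ρ ^ (-θ)`. The coefficients grow at most linearly
and `G` is Lipschitz, so a large `ρ` makes the dependence on the solution's own norm at most one
half; this gives the uniform bound `exists_apriori_bound`. The same lemma bounds `S h x - x` by a
multiple of `h ^ β` for the convolution value `x`. Hence solution values at a fixed positive time
are uniformly close to the image of a ball under the compact operator `S h`, and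
`exists_compact_values` follows.

Finally, pointwise compactness and equicontinuity yield the subsequence (`exists_subseq_tendsto`),
and dominated convergence passes to the limit in the equation (`isMildSolution_of_tendsto`). -/

theorem intervalIntegrable_rpow_mul_sub_rpow {a b t : ℝ} (ha : -1 < a) (hb : -1 < b) (ht : 0 < t) :
    IntervalIntegrable (fun r => r ^ a * (t - r) ^ b) volume 0 t := by
  -- The exponents are quantified afresh because the half near `t` is obtained by the reflection `r
  -- ↦ t - r`, which swaps them.
  have key : ∀ {a b : ℝ}, -1 < a →
      IntervalIntegrable (fun r => r ^ a * (t - r) ^ b) volume 0 (t / 2) := by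
    intro a b ha
    refine (intervalIntegral.intervalIntegrable_rpow' ha).mul_continuousOn ?_
    refine (continuousOn_const.sub continuousOn_id).rpow_const fun x hx => Or.inl ?_
    rw [uIcc_of_le (by linarith)] at hx
    exact (show 0 < t - x by linarith [hx.2]).ne'
  refine (key ha).trans ?_
  have h := (key (b := a) hb).comp_sub_left t
  simp only [sub_zero, sub_sub_cancel] at h
  rw [show t - t / 2 = t / 2 by ring] at h
  simpa only [mul_comm] using h.symm

/-- The beta integral `∫₀¹ r ^ a (1 - r) ^ b dr`. -/
def betaConst (a b : ℝ) : ℝ := ∫ r in (0 : ℝ)..1, r ^ a * (1 - r) ^ b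

theorem betaConst_nonneg (a b : ℝ) : 0 ≤ betaConst a b := by
  refine intervalIntegral.integral_nonneg zero_le_one fun r hr => ?_
  exact mul_nonneg (Real.rpow_nonneg hr.1 _) (Real.rpow_nonneg (by linarith [hr.2]) _)

theorem integral_rpow_mul_sub_rpow (a b : ℝ) {t : ℝ} (ht : 0 < t) :
    ∫ r in (0 : ℝ)..t, r ^ a * (t - r) ^ b = betaConst a b * t ^ (a + b + 1) := by
  have h := intervalIntegral.mul_integral_comp_mul_left (a := 0) (b := 1)
    (f := fun r : ℝ => r ^ a * (t - r) ^ b) t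
  rw [mul_zero, mul_one] at h
  rw [← h, betaConst, ← intervalIntegral.integral_const_mul, ← intervalIntegral.integral_mul_const]
  refine intervalIntegral.integral_congr fun r hr => ?_
  rw [uIcc_of_le zero_le_one] at hr
  have h1 : (t - t * r) = t * (1 - r) := by ring
  rw [h1, Real.mul_rpow ht.le hr.1, Real.mul_rpow ht.le (by linarith [hr.2]), Real.rpow_add ht,
    Real.rpow_add ht, Real.rpow_one]
  ring

theorem rpow_mul_exp_neg_le_one {x a : ℝ} (hx : 0 ≤ x) (ha : 0 ≤ a) (ha1 : a ≤ 1) :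
    x ^ a * Real.exp (-x) ≤ 1 := by
  have h1 : x ^ a ≤ Real.exp x := by
    rcases le_total x 1 with h | h
    · exact (Real.rpow_le_one hx h ha).trans (Real.one_le_exp hx)
    · calc x ^ a ≤ x ^ (1 : ℝ) := Real.rpow_le_rpow_of_exponent_le h ha1
        _ = x := Real.rpow_one x
        _ ≤ Real.exp x := by linarith [Real.add_one_le_exp x]
  rw [Real.exp_neg]
  exact mul_inv_le_one_of_le₀ h1 (Real.exp_pos _).le

theorem one_sub_exp_neg_le_rpow {x a : ℝ} (hx : 0 ≤ x) (ha : 0 ≤ a) (ha1 : a ≤ 1) :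
    1 - Real.exp (-x) ≤ x ^ a := by
  rcases le_total x 1 with h | h
  · have h1 : x ≤ x ^ a := by
      rcases hx.eq_or_lt with rfl | hx
      · exact Real.rpow_nonneg le_rfl _
      · simpa using Real.rpow_le_rpow_of_exponent_ge hx h ha1
    linarith [Real.add_one_le_exp (-x)]
  · linarith [Real.one_le_rpow h ha, Real.exp_pos (-x)]

/-- Scalar form of analytic smoothing, uniform in the eigenvalue `l`: the difference factors as `exp
(-l s) (1 - exp (-l (t - s)))`. The second factor is at most `(l (t - s)) ^ a`, and `(l s) ^ a exp
(-l s) ≤ 1` removes `l`. -/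
theorem exp_neg_sub_exp_neg_le {l s t a : ℝ} (hl : 0 ≤ l) (hs : 0 < s) (hst : s ≤ t)
    (ha : 0 ≤ a) (ha1 : a ≤ 1) :
    |Real.exp (-(l * t)) - Real.exp (-(l * s))| ≤ ((t - s) / s) ^ a := by
  have h0 : 0 ≤ t - s := sub_nonneg.2 hst
  have h1 : Real.exp (-(l * t)) = Real.exp (-(l * s)) * Real.exp (-(l * (t - s))) := by
    rw [← Real.exp_add]; ring_nf
  have h2 : Real.exp (-(l * (t - s))) ≤ 1 := Real.exp_le_one_iff.2 (by nlinarith)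
  have h3 : Real.exp (-(l * t)) - Real.exp (-(l * s))
      = -(Real.exp (-(l * s)) * (1 - Real.exp (-(l * (t - s))))) := by rw [h1]; ring
  rw [h3, abs_neg, abs_of_nonneg (mul_nonneg (Real.exp_pos _).le (by linarith))]
  have h4 := one_sub_exp_neg_le_rpow (mul_nonneg hl h0) ha ha1
  have h5 := rpow_mul_exp_neg_le_one (mul_nonneg hl hs.le) ha ha1
  have h6 : l * (t - s) = (l * s) * ((t - s) / s) := by field_simp
  calc _ ≤ Real.exp (-(l * s)) * (l * (t - s)) ^ a := by gcongr
    _ = ((l * s) ^ a * Real.exp (-(l * s))) * ((t - s) / s) ^ a := by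
        conv_lhs => rw [h6, Real.mul_rpow (mul_nonneg hl hs.le) (div_nonneg h0 hs.le)]
        ring
    _ ≤ 1 * ((t - s) / s) ^ a := by gcongr
    _ = _ := one_mul _

/-- A little integrability at `r = t` is traded for the small factor `ρ ^ (-a)`. This is what makes
the a priori estimate close for large `ρ`. -/
theorem exp_mul_le_rpow {ρ r t a : ℝ} (hρ : 0 < ρ) (hrt : r < t) (ha : 0 ≤ a) (ha1 : a ≤ 1) :
    Real.exp (ρ * r) ≤ Real.exp (ρ * t) * ρ ^ (-a) * (t - r) ^ (-a) := by
  have h0 : 0 < t - r := sub_pos.2 hrt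
  have h := rpow_mul_exp_neg_le_one (mul_pos hρ h0).le ha ha1
  have h1 : Real.exp (ρ * r) = Real.exp (ρ * t) * Real.exp (-(ρ * (t - r))) := by
    rw [← Real.exp_add]; ring_nf
  rw [h1, mul_assoc, ← Real.mul_rpow hρ.le h0.le, Real.rpow_neg (mul_pos hρ h0).le]
  gcongr
  rwa [← one_div, le_div_iff₀ (Real.rpow_pos_of_pos (mul_pos hρ h0) _), mul_comm]

/-- `1 ≤ T ^ a x ^ (-a)` for `0 < x ≤ T`. -/
theorem one_le_rpow_mul_rpow_neg {x T a : ℝ} (hx : 0 < x) (hxT : x ≤ T) (ha : 0 ≤ a) :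
    1 ≤ T ^ a * x ^ (-a) := by
  rw [Real.rpow_neg hx.le, ← div_eq_mul_inv, one_le_div (Real.rpow_pos_of_pos hx _)]
  exact Real.rpow_le_rpow hx.le hxT ha

theorem one_le_mul_rpow_neg {x T a : ℝ} (hT : 1 ≤ T) (hx : 0 < x) (hxT : x ≤ T) (ha : 0 ≤ a)
    (ha1 : a ≤ 1) : 1 ≤ T * x ^ (-a) := by
  refine (one_le_rpow_mul_rpow_neg hx hxT ha).trans ?_
  gcongr
  simpa using Real.rpow_le_rpow_of_exponent_le hT ha1

theorem integral_rpow_neg_Ioc {r s b : ℝ} (hr : r < s) (t : ℝ) (hst : s ≤ t) (hb : 1 < b) :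
    IntervalIntegrable (fun q => (q - r) ^ (-b)) volume s t ∧
      ∫ q in s..t, (q - r) ^ (-b) = ((s - r) ^ (1 - b) - (t - r) ^ (1 - b)) / (b - 1) := by
  have h0 : (0 : ℝ) ∉ uIcc (s - r) (t - r) := by
    rw [uIcc_of_le (by linarith)]
    exact fun h => by linarith [h.1]
  constructor
  · have := (intervalIntegral.intervalIntegrable_rpow (μ := volume) (r := -b)
      (Or.inr h0)).comp_sub_right r
    simpa using this
  · rw [intervalIntegral.integral_comp_sub_right (fun x => x ^ (-b)),
      integral_rpow (Or.inr ⟨by linarith, h0⟩), show -b + 1 = -(b - 1) by ring,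
      show 1 - b = -(b - 1) by ring]
    rw [div_neg, ← neg_div, neg_sub]

/-! ### Fractional derivatives of vector valued functions -/

section Frac

variable {E E' : Type*} [NormedAddCommGroup E] [NormedSpace ℝ E]
  [NormedAddCommGroup E'] [NormedSpace ℝ E']

/-- The left-sided fractional derivative with base point `0` of a vector valued function. -/
def leftFrac (α : ℝ) (f : ℝ → E) (r : ℝ) : E :=
  (1 / Real.Gamma (1 - α)) •
    ((r ^ α)⁻¹ • f r + α • ∫ q in (0 : ℝ)..r, ((r - q) ^ (1 + α))⁻¹ • (f r - f q))

/-- The right-sided fractional derivative of a vector valued function. -/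
def rightFrac (α t : ℝ) (f : ℝ → E) (r : ℝ) : E :=
  (1 / Real.Gamma α) •
    (((t - r) ^ (1 - α))⁻¹ • (f r - f t) +
      (1 - α) • ∫ q in r..t, ((q - r) ^ (2 - α))⁻¹ • (f r - f q))

theorem leftFracDeriv_eq_leftFrac (α : ℝ) (f : ℝ → ℝ) (r : ℝ) :
    leftFracDeriv α 0 f r = leftFrac α f r := by
  simp only [leftFracDeriv, leftFrac, smul_eq_mul, sub_zero, div_eq_inv_mul]

theorem rightFracDeriv_eq_rightFrac (α t : ℝ) (f : ℝ → ℝ) (r : ℝ) :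
    rightFracDeriv α t f r = rightFrac α t f r := by
  simp only [rightFracDeriv, rightFrac, smul_eq_mul, div_eq_inv_mul]

/-- The weighted Hölder condition at `r` under which the left-sided fractional derivative at `r`
is controlled. -/
structure LeftAdm (β γ K r : ℝ) (f : ℝ → E) : Prop where
  cont : ContinuousOn f (Ioo 0 r)
  bound : ‖f r‖ ≤ K
  holder : ∀ q ∈ Ioo 0 r, ‖f r - f q‖ ≤ K * q ^ (-β) * (r - q) ^ γ

theorem LeftAdm.nonneg {β γ K r : ℝ} {f : ℝ → E} (h : LeftAdm β γ K r f) : 0 ≤ K :=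
  (norm_nonneg _).trans h.bound

theorem LeftAdm.integrand_le {α β γ K r : ℝ} {f : ℝ → E} (h : LeftAdm β γ K r f) {q : ℝ}
    (hq : q ∈ Ioc 0 r) :
    ‖((r - q) ^ (1 + α))⁻¹ • (f r - f q)‖ ≤ K * (q ^ (-β) * (r - q) ^ (γ - α - 1)) := by
  have hK := h.nonneg
  rcases hq.2.eq_or_lt with rfl | hqr
  · simp only [sub_self, smul_zero, norm_zero]
    exact mul_nonneg hK (mul_nonneg (Real.rpow_nonneg hq.1.le _) (Real.rpow_nonneg le_rfl _))
  have h0 : 0 < r - q := sub_pos.2 hqr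
  rw [norm_smul, norm_inv, Real.norm_of_nonneg (Real.rpow_nonneg h0.le _)]
  calc _ ≤ ((r - q) ^ (1 + α))⁻¹ * (K * q ^ (-β) * (r - q) ^ γ) := by
        gcongr
        exact h.holder q ⟨hq.1, hqr⟩
    _ = _ := by
        rw [show γ - α - 1 = γ - (1 + α) by ring, Real.rpow_sub h0]
        ring

theorem aestronglyMeasurable_uIoc {a b : ℝ} (hab : a ≤ b) {f : ℝ → E}
    (hf : ContinuousOn f (Ioo a b)) : AEStronglyMeasurable f (volume.restrict (uIoc a b)) := by
  rw [uIoc_of_le hab, ← Measure.restrict_congr_set Ioo_ae_eq_Ioc]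
  exact hf.aestronglyMeasurable measurableSet_Ioo

theorem continuousOn_rpow_inv_smul {a b c r : ℝ} (hbr : b ≤ r) {g : ℝ → E}
    (hg : ContinuousOn g (Ioo a b)) :
    ContinuousOn (fun q => ((r - q) ^ c)⁻¹ • g q) (Ioo a b) := by
  refine ContinuousOn.smul (ContinuousOn.inv₀ ?_ ?_) hg
  · refine (continuousOn_const.sub continuousOn_id).rpow_const fun x hx => Or.inl ?_
    exact (show 0 < r - x by linarith [hx.2]).ne'
  · intro x hx
    exact (Real.rpow_pos_of_pos (by linarith [hx.2]) _).ne'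

theorem LeftAdm.aestronglyMeasurable {β γ K r : ℝ} {f : ℝ → E} (h : LeftAdm β γ K r f)
    (hr : 0 ≤ r) (c : ℝ) :
    AEStronglyMeasurable (fun q => ((r - q) ^ c)⁻¹ • (f r - f q)) (volume.restrict (uIoc 0 r)) :=
  aestronglyMeasurable_uIoc hr (continuousOn_rpow_inv_smul le_rfl (continuousOn_const.sub h.cont))

theorem LeftAdm.intervalIntegrable {α β γ K r : ℝ} {f : ℝ → E} (h : LeftAdm β γ K r f)
    (hr : 0 < r) (hβ : β < 1) (hαγ : α < γ) :
    IntervalIntegrable (fun q => ((r - q) ^ (1 + α))⁻¹ • (f r - f q)) volume 0 r := by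
  refine ((intervalIntegrable_rpow_mul_sub_rpow (a := -β) (b := γ - α - 1) (by linarith)
    (by linarith) hr).const_mul K).mono_fun' (h.aestronglyMeasurable hr.le _) ?_
  refine (ae_restrict_iff' measurableSet_uIoc).2 (ae_of_all _ fun q hq => ?_)
  rw [uIoc_of_le hr.le] at hq
  exact h.integrand_le hq

/-- A bounded operator passes through the Bochner integral because the inner integrand is
integrable. It is applied to coordinate functionals and to left composition with `S (t - s)` and `S
h - 1`. -/
theorem LeftAdm.leftFrac_comp {α β γ K r : ℝ} {f : ℝ → E} (h : LeftAdm β γ K r f)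
    (hr : 0 < r) (hβ : β < 1) (hαγ : α < γ) [CompleteSpace E] [CompleteSpace E'] (L : E →L[ℝ] E') :
    L (leftFrac α f r) = leftFrac α (fun q => L (f q)) r := by
  simp only [leftFrac, map_smul, map_add, ← map_sub]
  rw [← L.intervalIntegral_comp_comm (h.intervalIntegrable hr hβ hαγ)]
  simp only [map_smul]

/-- The constant in the bound for the left-sided fractional derivative. -/
def leftConst (α β γ T : ℝ) : ℝ :=
  |1 / Real.Gamma (1 - α)| * (T + |α| * (betaConst (-β) (γ - α - 1) * T))

theorem leftConst_nonneg (α β γ : ℝ) {T : ℝ} (hT : 0 ≤ T) : 0 ≤ leftConst α β γ T := by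
  have := betaConst_nonneg (-β) (γ - α - 1)
  unfold leftConst
  positivity

/-- The inner integral is dominated by a beta integral, so only the singularity `r ^ (-β)` of the
Hölder constant survives. The surplus powers `r ^ (β - α)` and `r ^ (γ - α)` are absorbed by `T ≥
1`. -/
theorem LeftAdm.norm_leftFrac_le {α β γ K r T : ℝ} {f : ℝ → E} (h : LeftAdm β γ K r f)
    (hr : 0 < r) (hrT : r ≤ T) (hT : 1 ≤ T) (hα : 0 < α) (hαγ : α < γ) (hγβ : γ ≤ β) (hβ : β < 1) :
    ‖leftFrac α f r‖ ≤ leftConst α β γ T * (K * r ^ (-β)) := by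
  have hK := h.nonneg
  have hpow : ∀ x : ℝ, 0 ≤ x → x ≤ 1 → r ^ x ≤ T := fun x hx hx1 =>
    (Real.rpow_le_rpow hr.le hrT hx).trans (by
      simpa using Real.rpow_le_rpow_of_exponent_le hT hx1)
  have hB := betaConst_nonneg (-β) (γ - α - 1)
  have hrβ := Real.rpow_nonneg hr.le (-β)
  rw [leftFrac, norm_smul, leftConst, mul_assoc, Real.norm_eq_abs, add_mul]
  refine mul_le_mul_of_nonneg_left ((norm_add_le _ _).trans (add_le_add ?_ ?_)) (abs_nonneg _)
  · rw [norm_smul, norm_inv, Real.norm_of_nonneg (Real.rpow_nonneg hr.le _), ← Real.rpow_neg hr.le,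
      show -α = (β - α) + -β by ring, Real.rpow_add hr]
    calc _ ≤ (T * r ^ (-β)) * K := by
          gcongr
          · exact hpow _ (by linarith) (by linarith)
          · exact h.bound
      _ = _ := by ring
  · rw [norm_smul, mul_assoc, Real.norm_eq_abs]
    refine mul_le_mul_of_nonneg_left ?_ (abs_nonneg _)
    calc _ ≤ ∫ q in (0 : ℝ)..r, K * (q ^ (-β) * (r - q) ^ (γ - α - 1)) := by
          refine intervalIntegral.norm_integral_le_of_norm_le hr.le
            (ae_of_all _ fun q hq => h.integrand_le hq) ?_
          exact (intervalIntegrable_rpow_mul_sub_rpow (by linarith) (by linarith) hr).const_mul K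
      _ = betaConst (-β) (γ - α - 1) * r ^ (γ - α) * (K * r ^ (-β)) := by
          rw [intervalIntegral.integral_const_mul, integral_rpow_mul_sub_rpow _ _ hr,
            show -β + (γ - α - 1) + 1 = (γ - α) + -β by ring, Real.rpow_add hr]
          ring
      _ ≤ _ := by
          gcongr
          exact hpow _ (by linarith) (by linarith)

theorem tendsto_leftFrac {α β γ K r : ℝ} {f : ℕ → ℝ → E} {g : ℝ → E}
    (h : ∀ n, LeftAdm β γ K r (f n)) (hr : 0 < r) (hαγ : α < γ) (hβ : β < 1)
    (hlim : ∀ q ∈ Ioc 0 r, Tendsto (fun n => f n q) atTop (𝓝 (g q))) :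
    Tendsto (fun n => leftFrac α (f n) r) atTop (𝓝 (leftFrac α g r)) := by
  have hr' := hlim r ⟨hr, le_rfl⟩
  refine ((hr'.const_smul _).add (Tendsto.const_smul ?_ _)).const_smul _
  refine intervalIntegral.tendsto_integral_filter_of_dominated_convergence
    (fun q => K * (q ^ (-β) * (r - q) ^ (γ - α - 1)))
    (Eventually.of_forall fun n => (h n).aestronglyMeasurable hr.le _)
    (Eventually.of_forall fun n => ae_of_all _ fun q hq => ?_) ?_
    (ae_of_all _ fun q hq => ?_)
  · rw [uIoc_of_le hr.le] at hq
    exact (h n).integrand_le hq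
  · exact (intervalIntegrable_rpow_mul_sub_rpow (by linarith) (by linarith) hr).const_mul K
  · rw [uIoc_of_le hr.le] at hq
    exact (hr'.sub (hlim q hq)).const_smul _

/-- The moving endpoint of the inner integral is encoded as the indicator of `q < r` on a fixed
square, where measurability of parameter integrals applies. -/
theorem aestronglyMeasurable_leftFrac (α : ℝ) {t : ℝ} {f : ℝ → E} (hf : ContinuousOn f (Ioo 0 t)) :
    AEStronglyMeasurable (leftFrac α f) (volume.restrict (Ioo 0 t)) := by
  have hm : AEStronglyMeasurable f (volume.restrict (Ioo 0 t)) :=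
    hf.aestronglyMeasurable measurableSet_Ioo
  have hJ : AEStronglyMeasurable (fun p : ℝ × ℝ => {p : ℝ × ℝ | p.2 < p.1}.indicator
      (fun p => ((p.1 - p.2) ^ (1 + α))⁻¹ • (f p.1 - f p.2)) p)
      ((volume.restrict (Ioo 0 t)).prod (volume.restrict (Ioo 0 t))) := by
    refine AEStronglyMeasurable.indicator ?_ (measurableSet_lt measurable_snd measurable_fst)
    refine AEStronglyMeasurable.smul ?_ (hm.comp_fst.sub hm.comp_snd)
    exact (((measurable_fst.sub measurable_snd).pow_const _).inv).aestronglyMeasurable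
  have hI := hJ.integral_prod_right'
  have hmain : AEStronglyMeasurable (fun r => (1 / Real.Gamma (1 - α)) •
      ((r ^ α)⁻¹ • f r + α • ∫ q in Ioo 0 t, {p : ℝ × ℝ | p.2 < p.1}.indicator
      (fun p => ((p.1 - p.2) ^ (1 + α))⁻¹ • (f p.1 - f p.2)) (r, q)))
      (volume.restrict (Ioo 0 t)) := by
    refine AEStronglyMeasurable.const_smul (AEStronglyMeasurable.add ?_ (hI.const_smul _)) _
    exact ((measurable_id.pow_const α).inv).aestronglyMeasurable.smul hm
  refine hmain.congr ((ae_restrict_iff' measurableSet_Ioo).2 (ae_of_all _ fun r hr => ?_))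
  simp only [leftFrac]
  congr 3
  rw [intervalIntegral.integral_of_le hr.1.le, integral_Ioc_eq_integral_Ioo]
  have : (fun q => {p : ℝ × ℝ | p.2 < p.1}.indicator
      (fun p => ((p.1 - p.2) ^ (1 + α))⁻¹ • (f p.1 - f p.2)) (r, q)) =
      (Iio r).indicator (fun q => ((r - q) ^ (1 + α))⁻¹ • (f r - f q)) := by
    ext q
    simp [indicator_apply]
  rw [this, integral_indicator measurableSet_Iio, Measure.restrict_restrict measurableSet_Iio]
  congr 2
  ext q
  simp only [mem_inter_iff, mem_Iio, mem_Ioo]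
  constructor
  · rintro ⟨h1, h2, h3⟩; exact ⟨h2, h1⟩
  · rintro ⟨h1, h2⟩; exact ⟨h2, h1, h2.trans hr.2⟩

theorem aestronglyMeasurable_rightFrac (α : ℝ) {t : ℝ} {f : ℝ → E} (hf : Continuous f) :
    AEStronglyMeasurable (rightFrac α t f) (volume.restrict (Ioo 0 t)) := by
  have hm : AEStronglyMeasurable f (volume.restrict (Ioo 0 t)) := hf.aestronglyMeasurable
  have hJ : AEStronglyMeasurable (fun p : ℝ × ℝ => {p : ℝ × ℝ | p.1 < p.2}.indicator
      (fun p => ((p.2 - p.1) ^ (2 - α))⁻¹ • (f p.1 - f p.2)) p)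
      ((volume.restrict (Ioo 0 t)).prod (volume.restrict (Ioo 0 t))) := by
    refine AEStronglyMeasurable.indicator ?_ (measurableSet_lt measurable_fst measurable_snd)
    refine AEStronglyMeasurable.smul ?_ (hm.comp_fst.sub hm.comp_snd)
    exact (((measurable_snd.sub measurable_fst).pow_const _).inv).aestronglyMeasurable
  have hI := hJ.integral_prod_right'
  have hmain : AEStronglyMeasurable (fun r => (1 / Real.Gamma α) •
      (((t - r) ^ (1 - α))⁻¹ • (f r - f t) + (1 - α) • ∫ q in Ioo 0 t,
      {p : ℝ × ℝ | p.1 < p.2}.indicator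
      (fun p => ((p.2 - p.1) ^ (2 - α))⁻¹ • (f p.1 - f p.2)) (r, q)))
      (volume.restrict (Ioo 0 t)) := by
    refine AEStronglyMeasurable.const_smul (AEStronglyMeasurable.add ?_ (hI.const_smul _)) _
    exact (((measurable_const.sub measurable_id).pow_const _).inv).aestronglyMeasurable.smul
      (hm.sub aestronglyMeasurable_const)
  refine hmain.congr ((ae_restrict_iff' measurableSet_Ioo).2 (ae_of_all _ fun r hr => ?_))
  simp only [rightFrac]
  congr 3
  rw [intervalIntegral.integral_of_le hr.2.le, integral_Ioc_eq_integral_Ioo]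
  have : (fun q => {p : ℝ × ℝ | p.1 < p.2}.indicator
      (fun p => ((p.2 - p.1) ^ (2 - α))⁻¹ • (f p.1 - f p.2)) (r, q)) =
      (Ioi r).indicator (fun q => ((q - r) ^ (2 - α))⁻¹ • (f r - f q)) := by
    ext q
    simp [indicator_apply]
  rw [this, integral_indicator measurableSet_Ioi, Measure.restrict_restrict measurableSet_Ioi]
  congr 2
  ext q
  simp only [mem_inter_iff, mem_Ioi, mem_Ioo]
  constructor
  · rintro ⟨h1, h2, h3⟩; exact ⟨h1, h3⟩
  · rintro ⟨h1, h2⟩; exact ⟨h1, hr.1.trans h1, h2⟩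

/-- `ω` is Hölder continuous on `[0, T]` with exponent `β'` and constant `M`. -/
structure HolderPath (β' M T : ℝ) (ω : ℝ → E) : Prop where
  cont : Continuous ω
  nonneg : 0 ≤ M
  holder : ∀ s t, 0 ≤ s → s ≤ t → t ≤ T → ‖ω s - ω t‖ ≤ M * (t - s) ^ β'

theorem HolderPath.integrand_le {α β' M T : ℝ} {ω : ℝ → E} (h : HolderPath β' M T ω)
    {r q : ℝ} (hr : 0 ≤ r) (hrq : r < q) (hqT : q ≤ T) :
    ‖((q - r) ^ (2 - α))⁻¹ • (ω r - ω q)‖ ≤ M * (q - r) ^ (β' + α - 2) := by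
  have h0 : 0 < q - r := sub_pos.2 hrq
  rw [norm_smul, norm_inv, Real.norm_of_nonneg (Real.rpow_nonneg h0.le _)]
  calc _ ≤ ((q - r) ^ (2 - α))⁻¹ * (M * (q - r) ^ β') := by
        gcongr
        exact h.holder r q hr hrq.le hqT
    _ = _ := by
        rw [show β' + α - 2 = -(2 - α) + β' by ring, Real.rpow_add h0, Real.rpow_neg h0.le]
        ring

theorem intervalIntegrable_sub_rpow {a r t : ℝ} (ha : -1 < a) :
    IntervalIntegrable (fun q => (q - r) ^ a) volume r t := by
  have := (intervalIntegral.intervalIntegrable_rpow' (a := 0) (b := t - r) ha).comp_sub_right r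
  simpa using this

theorem integral_sub_rpow {a r t : ℝ} (ha : -1 < a) :
    ∫ q in r..t, (q - r) ^ a = (t - r) ^ (a + 1) / (a + 1) := by
  rw [intervalIntegral.integral_comp_sub_right (fun x => x ^ a), integral_rpow (Or.inl ha),
    sub_self, Real.zero_rpow (by linarith), sub_zero]

theorem continuous_aestronglyMeasurable_rpow_smul {ω : ℝ → E} (h : Continuous ω) (c r : ℝ) (v : E)
    (μ : Measure ℝ) : AEStronglyMeasurable (fun q => ((q - r) ^ c)⁻¹ • (v - ω q)) μ :=
  (((measurable_id.sub_const r).pow_const c).inv).aestronglyMeasurable.smul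
    (continuous_const.sub h).aestronglyMeasurable

theorem HolderPath.intervalIntegrable {α β' M T : ℝ} {ω : ℝ → E} (h : HolderPath β' M T ω)
    (hα : 1 - β' < α) {r t : ℝ} (hr : 0 ≤ r) (hrt : r ≤ t) (htT : t ≤ T) :
    IntervalIntegrable (fun q => ((q - r) ^ (2 - α))⁻¹ • (ω r - ω q)) volume r t := by
  refine ((intervalIntegrable_sub_rpow (a := β' + α - 2) (by linarith)).const_mul M).mono_fun'
    (continuous_aestronglyMeasurable_rpow_smul h.cont _ _ _ _) ?_
  refine (ae_restrict_iff' measurableSet_uIoc).2 (ae_of_all _ fun q hq => ?_)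
  rw [uIoc_of_le hrt] at hq
  exact h.integrand_le hr hq.1 (hq.2.trans htT)

theorem HolderPath.rightFrac_comp {α β' M T : ℝ} {ω : ℝ → E} (h : HolderPath β' M T ω)
    (hα : 1 - β' < α) {r t : ℝ} (hr : 0 ≤ r) (hrt : r ≤ t) (htT : t ≤ T)
    [CompleteSpace E] [CompleteSpace E'] (L : E →L[ℝ] E') :
    L (rightFrac α t ω r) = rightFrac α t (fun q => L (ω q)) r := by
  simp only [rightFrac, map_smul, map_add, ← map_sub]
  rw [← L.intervalIntegral_comp_comm (h.intervalIntegrable hα hr hrt htT)]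
  simp only [map_smul]

/-- The constant in the bounds for the right-sided fractional derivative. -/
def rightConst (α β β' : ℝ) : ℝ :=
  |1 / Real.Gamma α| * (1 + (1 - α) * ((β' + α - 1)⁻¹ + (1 - α - (β' - β))⁻¹))

theorem HolderPath.norm_rightFrac_le {α β β' M T : ℝ} {ω : ℝ → E} (h : HolderPath β' M T ω)
    (hα : 1 - β' < α) (hβ' : β' < 1) (hαβ : α < β) (hββ' : β < β') {r t : ℝ} (hr : 0 ≤ r)
    (hrt : r < t)
    (htT : t ≤ T) :
    ‖rightFrac α t ω r‖ ≤ rightConst α β β' * (M * (t - r) ^ (β' + α - 1)) := by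
  have h0 : 0 < t - r := sub_pos.2 hrt
  have hM := h.nonneg
  have h1 : 0 < 1 - α - (β' - β) := by linarith
  have h2 : 0 < 1 - α := by linarith
  rw [rightFrac, norm_smul, rightConst, mul_assoc, Real.norm_eq_abs]
  refine mul_le_mul_of_nonneg_left ((norm_add_le _ _).trans ?_) (abs_nonneg _)
  have e1 : ‖((t - r) ^ (1 - α))⁻¹ • (ω r - ω t)‖ ≤ M * (t - r) ^ (β' + α - 1) := by
    rw [norm_smul, norm_inv, Real.norm_of_nonneg (Real.rpow_nonneg h0.le _)]
    calc _ ≤ ((t - r) ^ (1 - α))⁻¹ * (M * (t - r) ^ β') := by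
          gcongr
          exact h.holder r t hr hrt.le htT
      _ = _ := by
          rw [show β' + α - 1 = -(1 - α) + β' by ring, Real.rpow_add h0, Real.rpow_neg h0.le]
          ring
  have e2 : ‖∫ q in r..t, ((q - r) ^ (2 - α))⁻¹ • (ω r - ω q)‖ ≤
      (β' + α - 1)⁻¹ * (M * (t - r) ^ (β' + α - 1)) := by
    calc _ ≤ ∫ q in r..t, M * (q - r) ^ (β' + α - 2) :=
          intervalIntegral.norm_integral_le_of_norm_le hrt.le
            (ae_of_all _ fun q hq => h.integrand_le hr hq.1 (hq.2.trans htT))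
            ((intervalIntegrable_sub_rpow (by linarith)).const_mul M)
      _ = _ := by
          rw [intervalIntegral.integral_const_mul, integral_sub_rpow (by linarith),
            show β' + α - 2 + 1 = β' + α - 1 by ring]
          ring
  rw [norm_smul (1 - α), Real.norm_of_nonneg h2.le]
  have h3 : 0 ≤ M * (t - r) ^ (β' + α - 1) := mul_nonneg hM (Real.rpow_nonneg h0.le _)
  have h4 : 0 ≤ (1 - α - (β' - β))⁻¹ := inv_nonneg.2 h1.le
  calc _ ≤ M * (t - r) ^ (β' + α - 1) + (1 - α) * ((β' + α - 1)⁻¹ * (M * (t - r) ^ (β' + α - 1)) +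
        (1 - α - (β' - β))⁻¹ * (M * (t - r) ^ (β' + α - 1))) := by
        refine add_le_add e1 (mul_le_mul_of_nonneg_left (e2.trans ?_) h2.le)
        exact le_add_of_nonneg_right (mul_nonneg h4 h3)
    _ = _ := by ring

/-- The regularity `β'` of `ω` is split as `β + (β' - β)`: the part `β` yields `(t - s) ^ β`, the
surplus weakens the singularity at `r = s`. The exponents guarantee `1 - α - (β' - β) > 0`, so the
remaining integral is governed by its lower endpoint. -/
theorem HolderPath.norm_rightFrac_sub_le {α β β' M T : ℝ} {ω : ℝ → E} (h : HolderPath β' M T ω)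
    (hα : 1 - β' < α) (hβ' : β' < 1) (hαβ : α < β) (hββ' : β < β') {r s t : ℝ} (hr : 0 ≤ r)
    (hrs : r < s) (hst : s ≤ t) (htT : t ≤ T) [CompleteSpace E] :
    ‖rightFrac α t ω r - rightFrac α s ω r‖ ≤
      rightConst α β β' * (M * (t - s) ^ β * (s - r) ^ (α - 1 + (β' - β))) := by
  have h0 : 0 < s - r := sub_pos.2 hrs
  have h0t : 0 < t - r := by linarith
  have hst0 : 0 ≤ t - s := sub_nonneg.2 hst
  have hM := h.nonneg
  have h1 : 0 < 1 - α - (β' - β) := by linarith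
  have h2 : 0 < 1 - α := by linarith
  have hi1 := h.intervalIntegrable hα hr hrs.le (hst.trans htT)
  have hi := h.intervalIntegrable hα hr (hrs.le.trans hst) htT
  have hi2 : IntervalIntegrable (fun q => ((q - r) ^ (2 - α))⁻¹ • (ω r - ω q)) volume s t :=
    hi1.symm.trans hi
  obtain ⟨hp1, hp2⟩ := integral_rpow_neg_Ioc hrs t hst (b := 2 - α) (by linarith)
  have hpi : IntervalIntegrable (fun q => ((q - r) ^ (2 - α))⁻¹) volume s t := by
    refine hp1.congr fun q hq => ?_
    rw [uIoc_of_le hst] at hq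
    exact Real.rpow_neg (by linarith [hq.1]) _
  have hps : ∀ v : E, IntervalIntegrable (fun q => ((q - r) ^ (2 - α))⁻¹ • v) volume s t :=
    fun v => ⟨hpi.1.smul_const v, hpi.2.smul_const v⟩
  have hpv : ∫ q in s..t, ((q - r) ^ (2 - α))⁻¹ =
      ((s - r) ^ (α - 1) - (t - r) ^ (α - 1)) / (1 - α) := by
    rw [show α - 1 = 1 - (2 - α) by ring, show 1 - α = 2 - α - 1 by ring, ← hp2]
    refine intervalIntegral.integral_congr fun q hq => ?_
    rw [uIcc_of_le hst] at hq
    exact (Real.rpow_neg (by linarith [hq.1]) _).symm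
  have hi3 : IntervalIntegrable (fun q => ((q - r) ^ (2 - α))⁻¹ • (ω s - ω q)) volume s t := by
    refine (hi2.sub (hps (ω r - ω s))).congr fun q _ => ?_
    simp only [← smul_sub]
    congr 1
    abel
  have hsplit : ∫ q in s..t, ((q - r) ^ (2 - α))⁻¹ • (ω r - ω q) =
      (∫ q in s..t, ((q - r) ^ (2 - α))⁻¹ • (ω s - ω q)) +
        (((s - r) ^ (α - 1) - (t - r) ^ (α - 1)) / (1 - α)) • (ω r - ω s) := by
    rw [← hpv, ← intervalIntegral.integral_smul_const, ← intervalIntegral.integral_add hi3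
      (hps _)]
    refine intervalIntegral.integral_congr fun q _ => ?_
    simp only [← smul_add]
    congr 1
    abel
  -- Replacing `ω r` by `ω s` in the tail over `[s, t]` produces boundary terms: the one at `s`
  -- cancels the boundary term of `rightFrac α s`, the one at `t` turns `ω r - ω t` into `ω s - ω
  -- t`. Only increments of `ω` on `[s, t]` remain.
  have hid : rightFrac α t ω r - rightFrac α s ω r = (1 / Real.Gamma α) •
      ((t - r) ^ (α - 1) • (ω s - ω t) +
        (1 - α) • ∫ q in s..t, ((q - r) ^ (2 - α))⁻¹ • (ω s - ω q)) := by
    rw [rightFrac, rightFrac, ← smul_sub, ← intervalIntegral.integral_add_adjacent_intervals hi1 hi2,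
      hsplit, ← Real.rpow_neg h0t.le, ← Real.rpow_neg h0.le, neg_sub]
    congr 1
    rw [smul_add, smul_add, smul_smul, mul_div_cancel₀ _ h2.ne']
    module
  have hβ0 : 0 < β := by linarith
  have e1 : ‖(t - r) ^ (α - 1) • (ω s - ω t)‖ ≤
      M * (t - s) ^ β * (s - r) ^ (α - 1 + (β' - β)) := by
    rw [norm_smul, Real.norm_of_nonneg (Real.rpow_nonneg h0t.le _)]
    calc _ ≤ (t - r) ^ (α - 1) * (M * (t - s) ^ β') := by
          gcongr
          exact h.holder s t (by linarith) hst htT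
      _ = M * (t - s) ^ β * ((t - r) ^ (α - 1) * (t - s) ^ (β' - β)) := by
          rw [show β' = β + (β' - β) by ring, Real.rpow_add' hst0 (by linarith)]
          ring_nf
      _ ≤ M * (t - s) ^ β * ((t - r) ^ (α - 1) * (t - r) ^ (β' - β)) := by
          have : (t - s) ^ (β' - β) ≤ (t - r) ^ (β' - β) :=
            Real.rpow_le_rpow hst0 (by linarith) (by linarith)
          have := Real.rpow_nonneg hst0 β
          gcongr
      _ ≤ _ := by
          rw [← Real.rpow_add h0t]
          have := Real.rpow_nonneg hst0 β
          refine mul_le_mul_of_nonneg_left ?_ (by positivity)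
          exact Real.rpow_le_rpow_of_nonpos h0 (by linarith) (by linarith)
  have e2 : ‖∫ q in s..t, ((q - r) ^ (2 - α))⁻¹ • (ω s - ω q)‖ ≤
      (1 - α - (β' - β))⁻¹ * (M * (t - s) ^ β * (s - r) ^ (α - 1 + (β' - β))) := by
    obtain ⟨hk1, hk2⟩ := integral_rpow_neg_Ioc hrs t hst (b := 2 - α - (β' - β)) (by linarith)
    calc _ ≤ ∫ q in s..t, (M * (t - s) ^ β) * (q - r) ^ (-(2 - α - (β' - β))) := by
          refine intervalIntegral.norm_integral_le_of_norm_le hst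
            (ae_of_all _ fun q hq => ?_) (hk1.const_mul _)
          have hqr : 0 < q - r := by linarith [hq.1]
          have hqs : 0 ≤ q - s := by linarith [hq.1]
          rw [norm_smul, norm_inv, Real.norm_of_nonneg (Real.rpow_nonneg hqr.le _)]
          calc _ ≤ ((q - r) ^ (2 - α))⁻¹ * (M * (q - s) ^ β') := by
                gcongr
                exact h.holder s q (by linarith) hq.1.le (hq.2.trans htT)
            _ = ((q - r) ^ (2 - α))⁻¹ * (M * ((q - s) ^ β * (q - s) ^ (β' - β))) := by
                rw [← Real.rpow_add' hqs (by linarith)]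
                ring_nf
            _ ≤ ((q - r) ^ (2 - α))⁻¹ * (M * ((t - s) ^ β * (q - r) ^ (β' - β))) := by
                have : (q - s) ^ (β' - β) ≤ (q - r) ^ (β' - β) :=
                  Real.rpow_le_rpow hqs (by linarith) (by linarith)
                have : (q - s) ^ β ≤ (t - s) ^ β :=
                  Real.rpow_le_rpow hqs (by linarith [hq.2]) hβ0.le
                have := Real.rpow_nonneg hqs (β' - β)
                have := Real.rpow_nonneg hst0 β
                gcongr
            _ = _ := by
                rw [show -(2 - α - (β' - β)) = -(2 - α) + (β' - β) by ring, Real.rpow_add hqr,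
                  Real.rpow_neg hqr.le]
                ring
      _ ≤ _ := by
          rw [intervalIntegral.integral_const_mul, hk2,
            show 1 - (2 - α - (β' - β)) = α - 1 + (β' - β) by ring,
            show 2 - α - (β' - β) - 1 = 1 - α - (β' - β) by ring, mul_div_assoc', div_eq_inv_mul]
          have := Real.rpow_nonneg hst0 β
          have := Real.rpow_nonneg h0t.le (α - 1 + (β' - β))
          have : 0 ≤ (1 - α - (β' - β))⁻¹ := inv_nonneg.2 h1.le
          gcongr
          linarith
  rw [hid, norm_smul, rightConst, mul_assoc, Real.norm_eq_abs]
  refine mul_le_mul_of_nonneg_left ((norm_add_le _ _).trans ?_) (abs_nonneg _)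
  rw [norm_smul (1 - α), Real.norm_of_nonneg h2.le]
  have h3 : 0 ≤ M * (t - s) ^ β * (s - r) ^ (α - 1 + (β' - β)) :=
    mul_nonneg (mul_nonneg hM (Real.rpow_nonneg hst0 _)) (Real.rpow_nonneg h0.le _)
  have h4 : 0 ≤ (β' + α - 1)⁻¹ := inv_nonneg.2 (by linarith)
  calc _ ≤ M * (t - s) ^ β * (s - r) ^ (α - 1 + (β' - β)) +
        (1 - α) * ((β' + α - 1)⁻¹ * (M * (t - s) ^ β * (s - r) ^ (α - 1 + (β' - β))) +
        (1 - α - (β' - β))⁻¹ * (M * (t - s) ^ β * (s - r) ^ (α - 1 + (β' - β)))) := by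
        refine add_le_add e1 (mul_le_mul_of_nonneg_left (e2.trans ?_) h2.le)
        exact le_add_of_nonneg_left (mul_nonneg h4 h3)
    _ = _ := by ring

end Frac

/-! ### The semigroup -/

section Semigroup

variable {V : Type*} [NormedAddCommGroup V] [InnerProductSpace ℝ V]

/-- The properties of the analytic semigroup that are used: it is a strongly continuous semigroup
of contractions, compact and norm Hölder continuous at positive times. -/
structure SmoothingSemigroup (S : ℝ → V →L[ℝ] V) : Prop where
  contraction : ∀ t, 0 ≤ t → ‖S t‖ ≤ 1
  map_zero : S 0 = ContinuousLinearMap.id ℝ V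
  map_add : ∀ s t : ℝ, 0 ≤ s → 0 ≤ t → S (s + t) = (S s).comp (S t)
  strongly_continuous : ∀ x : V, ContinuousOn (fun t => S t x) (Ici 0)
  holder : ∀ s t a : ℝ, 0 < s → s ≤ t → 0 ≤ a → a ≤ 1 → ‖S t - S s‖ ≤ ((t - s) / s) ^ a
  compact : ∀ t, 0 < t → IsCompactOperator (S t)

variable {ι : Type*}

theorem inner_diagonal (e : HilbertBasis ι ℝ V) {B : V →L[ℝ] V} {m : ι → ℝ}
    (hB : ∀ i, B (e i) = m i • e i) (i : ι) (x : V) : ⟪e i, B x⟫ = m i * ⟪e i, x⟫ := by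
  classical
  have h : (innerSL ℝ (e i)).comp B = m i • innerSL ℝ (e i) := by
    refine ContinuousLinearMap.ext_on (s := range e) (by
      rw [dense_iff_closure_eq, ← Submodule.topologicalClosure_coe, e.dense_span]; rfl) ?_
    rintro _ ⟨j, rfl⟩
    have := orthonormal_iff_ite.1 e.orthonormal i j
    simp only [ContinuousLinearMap.comp_apply, hB, map_smul, _root_.smul_apply,
      innerSL_apply_apply, this, smul_eq_mul]
    split_ifs with hij
    · rw [hij]
    · simp
  simpa using congrArg (fun L => L x) h

theorem norm_le_of_diagonal (e : HilbertBasis ι ℝ V) {B : V →L[ℝ] V} {m : ι → ℝ}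
    (hB : ∀ i, B (e i) = m i • e i) {C : ℝ} (hC : 0 ≤ C) (hm : ∀ i, |m i| ≤ C) : ‖B‖ ≤ C := by
  refine B.opNorm_le_bound hC fun x => ?_
  have h1 := e.hasSum_inner_mul_inner (B x) (B x)
  have h2 := (e.hasSum_inner_mul_inner x x).mul_left (C ^ 2)
  have h3 : ⟪B x, B x⟫ ≤ C ^ 2 * ⟪x, x⟫ := by
    refine hasSum_le (fun i => ?_) h1 h2
    rw [real_inner_comm, inner_diagonal e hB, real_inner_comm x]
    have : m i ^ 2 ≤ C ^ 2 := sq_le_sq' (by linarith [abs_le.1 (hm i)]) (abs_le.1 (hm i)).2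
    nlinarith [mul_le_mul_of_nonneg_right this (sq_nonneg ⟪e i, x⟫)]
  rw [real_inner_self_eq_norm_sq, real_inner_self_eq_norm_sq, ← mul_pow] at h3
  exact abs_le_of_sq_le_sq' h3 (by positivity) |>.2

/-- The function `s ↦ exp (l s) S(s) x` is continuous with vanishing right derivative, hence
constant. Right derivatives suffice, and they are all that the definition of the generator provides.
-/
theorem semigroup_apply_eigenvector {S : ℝ → V →L[ℝ] V} {A : V →ₗ.[ℝ] V}
    (hS : IsSemigroupGeneratedBy S A) {x : V} {l : ℝ} (hx : (x, l • x) ∈ (-A).graph) {t : ℝ}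
    (ht : 0 ≤ t) : S t x = Real.exp (-(l * t)) • x := by
  have hgr : (x, -(l • x)) ∈ A.graph := by
    obtain ⟨y, hy1, hy2⟩ := (LinearPMap.mem_graph_iff _).1 hx
    refine (LinearPMap.mem_graph_iff _).2 ⟨y, hy1, ?_⟩
    simp only at hy2 ⊢
    rw [← hy2, LinearPMap.neg_apply, neg_neg]
  have hlim := (hS.generator _ _).1 hgr
  have hcont : ContinuousOn (fun s => Real.exp (l * s) • S s x) (Icc 0 t) :=
    (by fun_prop : Continuous fun s => Real.exp (l * s)).continuousOn.smul
      ((hS.strongly_continuous x).mono Icc_subset_Ici_self)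
  have hder : ∀ s ∈ Ico 0 t,
      HasDerivWithinAt (fun s => Real.exp (l * s) • S s x) 0 (Ici s) s := by
    intro s hs
    have h1 : HasDerivWithinAt (fun s => S s x) (S s (-(l • x))) (Ici s) s := by
      rw [← hasDerivWithinAt_Ioi_iff_Ici, hasDerivWithinAt_iff_tendsto_slope' self_notMem_Ioi]
      have hsub : Tendsto (fun y => y - s) (𝓝[>] s) (𝓝[>] 0) := by
        refine tendsto_nhdsWithin_iff.2 ⟨?_, ?_⟩
        · have : Tendsto (fun y => y - s) (𝓝 s) (𝓝 (s - s)) := tendsto_id.sub_const s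
          rw [sub_self] at this
          exact this.mono_left nhdsWithin_le_nhds
        · filter_upwards [self_mem_nhdsWithin] with y hy
          exact sub_pos.2 (show s < y from hy)
      refine (((S s).continuous.tendsto _).comp (hlim.comp hsub)).congr' ?_
      filter_upwards [self_mem_nhdsWithin] with y hy
      have hys : s < y := hy
      have hy' : 0 ≤ y - s := (sub_pos.2 hys).le
      have : S y = (S s).comp (S (y - s)) := by
        rw [← hS.map_add s (y - s) hs.1 hy']; ring_nf
      simp [slope, this, map_smul, map_sub]
    have h2 : HasDerivWithinAt (fun s => Real.exp (l * s)) (Real.exp (l * s) * l) (Ici s) s := by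
      have := ((hasDerivAt_id s).const_mul l).exp
      simpa using this.hasDerivWithinAt
    have h3 := h2.smul h1
    have hz : Real.exp (l * s) • S s (-(l • x)) + (Real.exp (l * s) * l) • S s x = 0 := by
      rw [map_neg, map_smul]
      module
    rwa [hz] at h3
  have := constant_of_has_deriv_right_zero hcont hder t ⟨ht, le_rfl⟩
  simp only [mul_zero, Real.exp_zero, one_smul, hS.map_zero, ContinuousLinearMap.id_apply] at this
  rw [← this, smul_smul, ← Real.exp_add, neg_add_cancel, Real.exp_zero, one_smul, this]

/-- Everything is diagonal in the eigenbasis, so operator norms are suprema of scalar multipliers.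
Strict positivity gives `l i > 0`; the compact inverse enters only in the compactness of `S t`. -/
theorem smoothingSemigroup [CompleteSpace V] {A : V →ₗ.[ℝ] V} (hA : IsAdmissibleOperator A)
    {S : ℝ → V →L[ℝ] V} (hS : IsSemigroupGeneratedBy S A) (e : HilbertBasis ι ℝ V)
    (he : IsEigenbasis A e) : SmoothingSemigroup S := by
  choose l hl using he
  have hSe : ∀ t, 0 ≤ t → ∀ i, S t (e i) = Real.exp (-(l i * t)) • e i := fun t ht i =>
    semigroup_apply_eigenvector hS (hl i) ht
  have hpos : ∀ i, 0 < l i := by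
    intro i
    obtain ⟨x, hx1, hx2⟩ := (LinearPMap.mem_graph_iff _).1 (hl i)
    have hne : (x : V) ≠ 0 := by
      rw [hx1]
      exact e.orthonormal.ne_zero i
    have := hA.strictlyPositive x hne
    simp only at hx1 hx2
    rw [hx2, hx1, real_inner_smul_left, real_inner_self_eq_norm_sq, e.orthonormal.1 i] at this
    simpa using this
  refine ⟨fun t ht => ?_, hS.map_zero, hS.map_add, hS.strongly_continuous,
    fun s t a hs hst ha ha1 => ?_, fun t ht => ?_⟩
  · refine norm_le_of_diagonal e (hSe t ht) zero_le_one fun i => ?_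
    rw [abs_of_pos (Real.exp_pos _), Real.exp_le_one_iff]
    nlinarith [(hpos i).le]
  · refine norm_le_of_diagonal e
      (m := fun i => Real.exp (-(l i * t)) - Real.exp (-(l i * s))) (fun i => ?_)
      (Real.rpow_nonneg (div_nonneg (sub_nonneg.2 hst) hs.le) _)
      (fun i => exp_neg_sub_exp_neg_le (hpos i).le hs hst ha ha1)
    rw [_root_.sub_apply, hSe t (hs.le.trans hst), hSe s hs.le, sub_smul]
  · obtain ⟨K, hK, -, hKA⟩ := hA.compactInverse
    have hKe : ∀ i, K (e i) = (l i)⁻¹ • e i := by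
      intro i
      obtain ⟨x, hx1, hx2⟩ := (LinearPMap.mem_graph_iff _).1 (hl i)
      have := hKA x
      simp only at hx1 hx2
      rw [hx2, hx1, map_smul] at this
      rw [← this, smul_smul, inv_mul_cancel₀ (hpos i).ne', one_smul, this]
    -- With `h = 1 / (n + 1)`, the operator `h⁻¹ S(t) K (1 - S(h))` is compact because `K` is. Its
    -- multiplier is `exp (-l t) (1 - exp (-l h)) / (l h)`, which is within `exp (-l t) l h ≤ h / t`
    -- of `exp (-l t)`. Thus `S t` is a norm limit of compact operators.
    let R : ℕ → V →L[ℝ] V := fun n => ((n : ℝ) + 1) •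
      (S t).comp (K.comp (ContinuousLinearMap.id ℝ V - S (1 / ((n : ℝ) + 1))))
    refine isCompactOperator_of_tendsto (F := R) (l := atTop) ?_
      (Eventually.of_forall fun n => ((hK.comp_clm _).clm_comp _).smul _)
    rw [tendsto_iff_norm_sub_tendsto_zero]
    have hbound : ∀ n : ℕ, ‖R n - S t‖ ≤ t⁻¹ * (1 / ((n : ℝ) + 1)) := by
      intro n
      set h : ℝ := 1 / ((n : ℝ) + 1) with hh
      have hn : (0 : ℝ) < (n : ℝ) + 1 := by positivity
      have h0 : 0 < h := by positivity
      have hinv : (n : ℝ) + 1 = h⁻¹ := by rw [hh, one_div, inv_inv]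
      refine norm_le_of_diagonal e (m := fun i => h⁻¹ * ((1 - Real.exp (-(l i * h))) *
        ((l i)⁻¹ * Real.exp (-(l i * t)))) - Real.exp (-(l i * t))) (fun i => ?_) (by positivity)
        (fun i => ?_)
      · have hR : R n = h⁻¹ • (S t).comp (K.comp (ContinuousLinearMap.id ℝ V - S h)) := by
          simp only [R, hinv, one_div, inv_inv]
        rw [hR]
        simp only [_root_.sub_apply, _root_.smul_apply,
          ContinuousLinearMap.comp_apply, ContinuousLinearMap.id_apply, hSe h h0.le, hSe t ht.le,
          map_sub, map_smul, hKe]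
        module
      · have hli := hpos i
        set x := l i * h with hx
        have hx0 : 0 < x := mul_pos hli h0
        have e1 : h⁻¹ * ((1 - Real.exp (-x)) * ((l i)⁻¹ * Real.exp (-(l i * t)))) -
            Real.exp (-(l i * t)) = -(Real.exp (-(l i * t)) * (1 - (1 - Real.exp (-x)) / x)) := by
          rw [hx]; field_simp; ring
        have e2 : (1 - Real.exp (-x)) / x ≤ 1 := by
          rw [div_le_one hx0]; linarith [Real.add_one_le_exp (-x)]
        have e3 : 1 - x ≤ (1 - Real.exp (-x)) / x := by
          rw [le_div_iff₀ hx0]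
          have h5 : Real.exp (-x) * (1 + x) ≤ 1 := by
            rw [Real.exp_neg, inv_mul_le_one₀ (Real.exp_pos _)]
            linarith [Real.add_one_le_exp x]
          have h6 : Real.exp (-x) ≤ 1 / (1 + x) := by
            rwa [le_div_iff₀ (by linarith)]
          have h7 : 1 / (1 + x) ≤ 1 - (1 - x) * x := by
            rw [div_le_iff₀ (by linarith)]
            nlinarith [pow_pos hx0 3]
          linarith
        have e4 := rpow_mul_exp_neg_le_one (x := l i * t) (by positivity) zero_le_one le_rfl
        rw [Real.rpow_one] at e4
        rw [e1, abs_neg, abs_of_nonneg (mul_nonneg (Real.exp_pos _).le (by linarith))]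
        calc _ ≤ Real.exp (-(l i * t)) * x := by gcongr; linarith
          _ = (l i * t * Real.exp (-(l i * t))) * (t⁻¹ * h) := by rw [hx]; field_simp
          _ ≤ 1 * (t⁻¹ * h) := by gcongr
          _ = _ := one_mul _
    refine squeeze_zero (fun _ => norm_nonneg _) hbound ?_
    simpa using (tendsto_one_div_add_atTop_nhds_zero_nat (𝕜 := ℝ)).const_mul t⁻¹

/-- Distinct basis vectors are at distance `√2`, so the balls of radius `1/2` are disjoint.
Countability is needed for dominated convergence along finite subsets of the basis. -/
theorem countable_of_hilbertBasis [TopologicalSpace.SeparableSpace V] (e : HilbertBasis ι ℝ V) :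
    Countable ι := by
  classical
  have hd : ∀ i j, i ≠ j → 1 ≤ dist (e i) (e j) := by
    intro i j hij
    have h1 : ‖e i - e j‖ ^ 2 = 2 := by
      rw [@norm_sub_sq_real, e.orthonormal.1, e.orthonormal.1, e.orthonormal.2 hij]
      norm_num
    rw [dist_eq_norm]
    nlinarith [norm_nonneg (e i - e j)]
  refine Pairwise.countable_of_isOpen_disjoint (s := fun i => Metric.ball (e i) (1 / 2)) ?_
    (fun _ => Metric.isOpen_ball) (fun i => ⟨e i, Metric.mem_ball_self (by norm_num)⟩)
  intro i j hij
  refine Metric.ball_disjoint_ball ?_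
  linarith [hd i j hij]

theorem SmoothingSemigroup.continuousOn {S : ℝ → V →L[ℝ] V} (hS : SmoothingSemigroup S) :
    ContinuousOn S (Ioi 0) := by
  intro s hs
  refine ContinuousAt.continuousWithinAt ?_
  have hs0 : (0 : ℝ) < s := hs
  rw [ContinuousAt, tendsto_iff_norm_sub_tendsto_zero]
  have hb : ∀ᶠ t in 𝓝 s, ‖S t - S s‖ ≤ 2 / s * |t - s| := by
    filter_upwards [lt_mem_nhds (show s / 2 < s by linarith)] with t ht
    rcases le_total s t with h | h
    · have := hS.holder s t 1 hs0 h zero_le_one le_rfl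
      rw [Real.rpow_one] at this
      refine this.trans ?_
      rw [abs_of_nonneg (sub_nonneg.2 h), div_mul_eq_mul_div]
      gcongr
      linarith
    · have ht0 : 0 < t := by linarith
      have := hS.holder t s 1 ht0 h zero_le_one le_rfl
      rw [Real.rpow_one] at this
      rw [norm_sub_rev]
      refine this.trans ?_
      rw [abs_of_nonpos (sub_nonpos.2 h), neg_sub, div_mul_eq_mul_div, div_le_div_iff₀ ht0 hs0]
      nlinarith
  refine squeeze_zero' (Eventually.of_forall fun _ => norm_nonneg _) hb ?_
  have : Tendsto (fun t => 2 / s * |t - s|) (𝓝 s) (𝓝 (2 / s * |s - s|)) :=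
    (Continuous.tendsto (by fun_prop) s)
  simpa using this

end Semigroup

/-! ### The integrand of the mild formulation -/

/-- Relations between the exponents: `γ` is an auxiliary Hölder exponent, and `θ` measures the
regularity that is gained. -/
structure Exponents (α β β' γ θ : ℝ) : Prop where
  α_pos : 0 < α
  α_gt : 1 - β' < α
  α_lt : α < γ
  γ_le : γ ≤ β
  β_lt : β < β'
  β'_lt : β' < 1
  two_θ : 2 * θ = β' - β + α - γ
  θ_pos : 0 < θ

/-- The exponent `γ` must exceed `α`, so that the left derivative converges, and stay below `α + (β'
- β)`, so that a positive power is left over. This leftover `2 * θ` is later halved: one `θ` pays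
for `ρ ^ (-θ)`, the other keeps the kernels integrable. -/
theorem exists_exponents {α β β' : ℝ} (hββ' : β < β') (hβ' : β' < 1) (hα : 1 - β' < α)
    (hαβ : α < β) : ∃ γ θ, Exponents α β β' γ θ := by
  refine ⟨min β (α + (β' - β) / 2), (β' - β + α - min β (α + (β' - β) / 2)) / 2, by linarith, hα,
    lt_min hαβ (by linarith), min_le_left _ _, hββ', hβ', by ring, ?_⟩
  have := min_le_right β (α + (β' - β) / 2)
  linarith

theorem rpow_le_self_of_one_le {x T a : ℝ} (hx : 0 ≤ x) (hxT : x ≤ T) (hT : 1 ≤ T) (ha : 0 ≤ a)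
    (ha1 : a ≤ 1) : x ^ a ≤ T :=
  (Real.rpow_le_rpow hx hxT ha).trans (by simpa using Real.rpow_le_rpow_of_exponent_le hT ha1)

section Weight

variable {E : Type*} [NormedAddCommGroup E]

/-- Bounds in the weighted Hölder space with exponential weights. -/
structure WeightAdm (β ρ K T : ℝ) (H : ℝ → E) : Prop where
  nonneg : 0 ≤ K
  cont : ContinuousOn H (Ioc 0 T)
  bound : ∀ r ∈ Ioc 0 T, ‖H r‖ ≤ K * Real.exp (ρ * r)
  holder : ∀ q r, 0 < q → q < r → r ≤ T →
    ‖H r - H q‖ ≤ K * Real.exp (ρ * r) * q ^ (-β) * (r - q) ^ β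

end Weight

section Integrand

variable {V : Type*} [NormedAddCommGroup V] [InnerProductSpace ℝ V]

theorem leftFrac_congr {E : Type*} [NormedAddCommGroup E] [NormedSpace ℝ E] {α r : ℝ}
    {f g : ℝ → E} (hr : 0 < r) (h : EqOn f g (Ioc 0 r)) : leftFrac α f r = leftFrac α g r := by
  have hr' := h ⟨hr, le_rfl⟩
  rw [leftFrac, leftFrac, hr']
  congr 3
  rw [intervalIntegral.integral_of_le hr.le, intervalIntegral.integral_of_le hr.le]
  exact setIntegral_congr_fun measurableSet_Ioc fun q hq => by rw [h hq]

/-- Product rule for Hölder functions. The factor `2 * T` comes from two terms, brought to the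
common form `q ^ (-β) (r - q) ^ γ` by `1 ≤ T q ^ (-β)` and `(r - q) ^ β ≤ T (r - q) ^ γ`. -/
theorem leftAdm_comp {β γ ρ Λ T κ r : ℝ} {P H : ℝ → V →L[ℝ] V} (hH : WeightAdm β ρ Λ T H)
    (hr : 0 < r) (hrT : r ≤ T) (hT : 1 ≤ T) (hγ : 0 ≤ γ) (hγβ : γ ≤ β) (hβ : β ≤ 1)
    (hP : ContinuousOn P (Ioo 0 r)) (hPb : ∀ q ∈ Ioc 0 r, ‖P q‖ ≤ κ)
    (hPh : ∀ q ∈ Ioo 0 r, ‖P r - P q‖ ≤ κ * (r - q) ^ γ) :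
    LeftAdm β γ (2 * T * κ * (Λ * Real.exp (ρ * r))) r (fun q => (P q).comp (H q)) := by
  have hΛ : 0 ≤ Λ * Real.exp (ρ * r) := mul_nonneg hH.nonneg (Real.exp_pos _).le
  have hκ : 0 ≤ κ := (norm_nonneg _).trans (hPb r ⟨hr, le_rfl⟩)
  refine ⟨hP.clm_comp (hH.cont.mono fun q hq => ⟨hq.1, hq.2.le.trans hrT⟩), ?_, fun q hq => ?_⟩
  · calc _ ≤ ‖P r‖ * ‖H r‖ := ContinuousLinearMap.opNorm_comp_le _ _
      _ ≤ κ * (Λ * Real.exp (ρ * r)) := by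
          gcongr
          · exact hPb r ⟨hr, le_rfl⟩
          · exact hH.bound r ⟨hr, hrT⟩
      _ = 1 * κ * (Λ * Real.exp (ρ * r)) := by ring
      _ ≤ _ := by gcongr; linarith
  · have hq0 := hq.1
    have hrq : 0 < r - q := sub_pos.2 hq.2
    have e0 : (P r).comp (H r) - (P q).comp (H q) =
        (P r - P q).comp (H r) + (P q).comp (H r - H q) := by
      ext x
      simp
    have h1 : 1 ≤ T * q ^ (-β) :=
      one_le_mul_rpow_neg hT hq0 (hq.2.le.trans hrT) (by linarith) hβ
    have h2 : (r - q) ^ β ≤ T * (r - q) ^ γ := by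
      rw [show β = (β - γ) + γ by ring, Real.rpow_add hrq]
      gcongr
      exact rpow_le_self_of_one_le hrq.le (by linarith) hT (by linarith) (by linarith)
    rw [e0]
    have hg := Real.rpow_nonneg hrq.le γ
    have hqβ := Real.rpow_nonneg hq0.le (-β)
    calc _ ≤ ‖P r - P q‖ * ‖H r‖ + ‖P q‖ * ‖H r - H q‖ :=
          (norm_add_le _ _).trans (add_le_add (ContinuousLinearMap.opNorm_comp_le _ _)
            (ContinuousLinearMap.opNorm_comp_le _ _))
      _ ≤ (κ * (r - q) ^ γ) * (Λ * Real.exp (ρ * r)) +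
          κ * (Λ * Real.exp (ρ * r) * q ^ (-β) * (r - q) ^ β) := by
          gcongr
          · exact hPh q hq
          · exact hH.bound r ⟨hr, hrT⟩
          · exact hPb q ⟨hq0, hq.2.le⟩
          · exact hH.holder q r hq0 hq.2 hrT
      _ ≤ (κ * (r - q) ^ γ) * (Λ * Real.exp (ρ * r)) * (T * q ^ (-β)) +
          κ * (Λ * Real.exp (ρ * r) * q ^ (-β) * (T * (r - q) ^ γ)) := by
          refine add_le_add (le_mul_of_one_le_right (by positivity) h1) ?_
          gcongr
      _ = _ := by ring

variable {S : ℝ → V →L[ℝ] V}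

theorem SmoothingSemigroup.norm_apply_le (hS : SmoothingSemigroup S) {t : ℝ} (ht : 0 ≤ t) (x : V) :
    ‖S t x‖ ≤ ‖x‖ := by
  simpa using (S t).le_of_opNorm_le (hS.contraction t ht) x

theorem SmoothingSemigroup.continuousOn_sub (hS : SmoothingSemigroup S) {r t : ℝ} (hrt : r ≤ t) :
    ContinuousOn (fun q => S (t - q)) (Ioo 0 r) := by
  refine hS.continuousOn.comp (continuousOn_const.sub continuousOn_id) fun q hq => ?_
  exact show 0 < t - q by linarith [hq.2]

theorem SmoothingSemigroup.norm_increment_le (hS : SmoothingSemigroup S) {h s a : ℝ} (hh : 0 ≤ h)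
    (hs : 0 < s) (ha : 0 ≤ a) (ha1 : a ≤ 1) :
    ‖(S h - ContinuousLinearMap.id ℝ V).comp (S s)‖ ≤ h ^ a * s ^ (-a) := by
  have := hS.holder s (h + s) a hs (by linarith) ha ha1
  rw [add_sub_cancel_right, Real.div_rpow hh hs.le, div_eq_mul_inv, ← Real.rpow_neg hs.le,
    hS.map_add h s hh hs.le] at this
  simpa [ContinuousLinearMap.sub_comp] using this

theorem leftAdm_semigroup (hS : SmoothingSemigroup S) {β γ ρ Λ T r t : ℝ} {H : ℝ → V →L[ℝ] V}
    (hH : WeightAdm β ρ Λ T H) (hr : 0 < r) (hrt : r < t) (htT : t ≤ T) (hT : 1 ≤ T) (hγ : 0 ≤ γ)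
    (hγβ : γ ≤ β) (hβ : β ≤ 1) :
    LeftAdm β γ (2 * T * (T * (t - r) ^ (-γ)) * (Λ * Real.exp (ρ * r))) r
      (fun q => (S (t - q)).comp (H q)) := by
  have htr : 0 < t - r := sub_pos.2 hrt
  refine leftAdm_comp hH hr (hrt.le.trans htT) hT hγ hγβ hβ (hS.continuousOn_sub hrt.le)
    (fun q hq => ?_) (fun q hq => ?_)
  · exact (hS.contraction _ (by linarith [hq.2])).trans
      (one_le_mul_rpow_neg hT htr (by linarith) hγ (by linarith))
  · rw [norm_sub_rev]
    have := hS.holder (t - r) (t - q) γ htr (by linarith [hq.2]) hγ (by linarith)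
    have hrq : 0 < r - q := sub_pos.2 hq.2
    rw [show t - q - (t - r) = r - q by ring, Real.div_rpow hrq.le htr.le, div_eq_mul_inv,
      ← Real.rpow_neg htr.le] at this
    calc _ ≤ 1 * (t - r) ^ (-γ) * (r - q) ^ γ := by linarith
      _ ≤ _ := by gcongr

theorem leftAdm_increment (hS : SmoothingSemigroup S) {β γ ρ Λ T r s h : ℝ} {H : ℝ → V →L[ℝ] V}
    (hH : WeightAdm β ρ Λ T H) (hr : 0 < r) (hrs : r < s) (hsT : s ≤ T) (hT : 1 ≤ T) (hγ : 0 ≤ γ)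
    (hγβ : γ ≤ β) (hβ : β ≤ 1) (hh : 0 ≤ h) :
    LeftAdm β γ (2 * T * (4 * T * h ^ β * (s - r) ^ (-β - γ)) * (Λ * Real.exp (ρ * r))) r
      (fun q => ((S h - ContinuousLinearMap.id ℝ V).comp (S (s - q))).comp (H q)) := by
  have hsr : 0 < s - r := sub_pos.2 hrs
  have hβ0 : 0 ≤ β := hγ.trans hγβ
  have hhβ := Real.rpow_nonneg hh β
  refine leftAdm_comp hH hr (hrs.le.trans hsT) hT hγ hγβ hβ
    (continuousOn_const.clm_comp (hS.continuousOn_sub hrs.le)) (fun q hq => ?_) (fun q hq => ?_)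
  · have h1 : 1 ≤ T * (s - r) ^ (-γ) :=
      one_le_mul_rpow_neg hT hsr (by linarith) hγ (by linarith)
    have h2 : (s - q) ^ (-β) ≤ (s - r) ^ (-β) :=
      Real.rpow_le_rpow_of_nonpos hsr (by linarith [hq.2]) (by linarith)
    calc _ ≤ h ^ β * (s - q) ^ (-β) :=
          hS.norm_increment_le hh (by linarith [hq.2]) hβ0 hβ
      _ ≤ h ^ β * (s - r) ^ (-β) * (T * (s - r) ^ (-γ)) :=
          (mul_le_mul_of_nonneg_left h2 hhβ).trans (le_mul_of_one_le_right (by positivity) h1)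
      _ = 1 * T * h ^ β * (s - r) ^ (-β - γ) := by
          rw [show -β - γ = -β + -γ by ring, Real.rpow_add hsr]
          ring
      _ ≤ _ := by gcongr; norm_num
  · have hrq : 0 < r - q := sub_pos.2 hq.2
    -- The smoothing time `s - r` is used in two halves: one pays for the increment `S h - 1`, the
    -- other for the Hölder dependence on `q`. The constant `4` bounds `2 ^ (β + γ)`.
    set m := (s - r) / 2 with hm
    have hm0 : 0 < m := by positivity
    have e1 : S (s - r) = (S m).comp (S m) := by
      rw [← hS.map_add m m hm0.le hm0.le]
      congr 1
      rw [hm]; ring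
    have e2 : S (s - q) = (S m).comp (S (m + (r - q))) := by
      rw [← hS.map_add m _ hm0.le (by linarith)]
      congr 1
      rw [hm]; ring
    have e3 : (S h - ContinuousLinearMap.id ℝ V).comp (S (s - r)) -
        (S h - ContinuousLinearMap.id ℝ V).comp (S (s - q)) =
        ((S h - ContinuousLinearMap.id ℝ V).comp (S m)).comp (S m - S (m + (r - q))) := by
      rw [e1, e2]
      ext x
      simp
    have h1 := hS.norm_increment_le hh hm0 hβ0 hβ
    have h2 := hS.holder m (m + (r - q)) γ hm0 (by linarith) hγ (by linarith)
    rw [add_sub_cancel_left, norm_sub_rev, Real.div_rpow hrq.le hm0.le, div_eq_mul_inv,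
      ← Real.rpow_neg hm0.le] at h2
    have h3 : m ^ (-β - γ) ≤ 4 * (s - r) ^ (-β - γ) := by
      rw [hm, Real.div_rpow hsr.le zero_le_two, div_eq_mul_inv, mul_comm,
        ← Real.rpow_neg zero_le_two]
      gcongr
      calc (2 : ℝ) ^ (-(-β - γ)) ≤ 2 ^ (2 : ℝ) :=
            Real.rpow_le_rpow_of_exponent_le one_le_two (by linarith)
        _ = 4 := by norm_num
    rw [e3]
    calc _ ≤ (h ^ β * m ^ (-β)) * ((r - q) ^ γ * m ^ (-γ)) :=
          (ContinuousLinearMap.opNorm_comp_le _ _).trans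
            (mul_le_mul h1 h2 (norm_nonneg _) (by positivity))
      _ = h ^ β * m ^ (-β - γ) * (r - q) ^ γ := by
          rw [show -β - γ = -β + -γ by ring, Real.rpow_add hm0]
          ring
      _ ≤ h ^ β * (4 * (s - r) ^ (-β - γ)) * (r - q) ^ γ := by gcongr
      _ = 4 * 1 * h ^ β * (s - r) ^ (-β - γ) * (r - q) ^ γ := by ring
      _ ≤ _ := by gcongr

/-- The left-sided fractional derivative at `r` of `q ↦ S (t - q) H(q)`. -/
def convFrac (S : ℝ → V →L[ℝ] V) (α : ℝ) (H : ℝ → V →L[ℝ] V) (t r : ℝ) : V →L[ℝ] V :=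
  leftFrac α (fun q => (S (t - q)).comp (H q)) r

/-- The fractional derivative at `r` only sees times `q ≤ r < s`, so `S (t - s)` factors out of
every term. Comparing the convolutions at `t` and `s` then reduces to comparing the derivatives of
`ω`. -/
theorem convFrac_shift [CompleteSpace V] (hS : SmoothingSemigroup S) {α β β' γ θ : ℝ}
    (hE : Exponents α β β' γ θ) {ρ Λ T r s t : ℝ} {H : ℝ → V →L[ℝ] V} (hH : WeightAdm β ρ Λ T H)
    (hT : 1 ≤ T) (hr : 0 < r) (hrs : r < s) (hst : s ≤ t) (hsT : s ≤ T) :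
    convFrac S α H t r = (S (t - s)).comp (convFrac S α H s r) := by
  obtain ⟨hα, -, hαγ, hγβ, hββ', hβ', -, -⟩ := hE
  have h := (leftAdm_semigroup hS hH hr hrs hsT hT (hα.trans hαγ).le hγβ
    (by linarith)).leftFrac_comp (α := α) hr (by linarith) hαγ
    (ContinuousLinearMap.compL ℝ V V V (S (t - s)))
  rw [ContinuousLinearMap.compL_apply] at h
  rw [convFrac, convFrac, h]
  refine leftFrac_congr hr fun q hq => ?_
  have : S (t - q) = (S (t - s)).comp (S (s - q)) := by
    rw [← hS.map_add _ _ (sub_nonneg.2 hst) (by linarith [hq.2])]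
    congr 1
    ring
  rw [ContinuousLinearMap.compL_apply, this]
  rfl

theorem norm_convFrac_le (hS : SmoothingSemigroup S) {α β β' γ θ : ℝ}
    (hE : Exponents α β β' γ θ) {ρ Λ T r t : ℝ} {H : ℝ → V →L[ℝ] V} (hH : WeightAdm β ρ Λ T H)
    (hT : 1 ≤ T) (hr : 0 < r) (hrt : r < t) (htT : t ≤ T) :
    ‖convFrac S α H t r‖ ≤
      leftConst α β γ T * (2 * T * T) * ((Λ * Real.exp (ρ * r)) * (r ^ (-β) * (t - r) ^ (-γ))) := by
  obtain ⟨hα, -, hαγ, hγβ, hββ', hβ', -, -⟩ := hE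
  refine ((leftAdm_semigroup hS hH hr hrt htT hT (hα.trans hαγ).le hγβ
    (by linarith)).norm_leftFrac_le hr (hrt.le.trans htT) hT hα hαγ hγβ (by linarith)).trans_eq ?_
  ring

theorem norm_increment_convFrac_le [CompleteSpace V] (hS : SmoothingSemigroup S) {α β β' γ θ : ℝ}
    (hE : Exponents α β β' γ θ) {ρ Λ T r s h : ℝ} {H : ℝ → V →L[ℝ] V} (hH : WeightAdm β ρ Λ T H)
    (hT : 1 ≤ T) (hr : 0 < r) (hrs : r < s) (hsT : s ≤ T) (hh : 0 ≤ h) :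
    ‖(S h - ContinuousLinearMap.id ℝ V).comp (convFrac S α H s r)‖ ≤
      leftConst α β γ T * (8 * T * T) *
        ((Λ * Real.exp (ρ * r)) * h ^ β * (r ^ (-β) * (s - r) ^ (-β - γ))) := by
  obtain ⟨hα, -, hαγ, hγβ, hββ', hβ', -, -⟩ := hE
  have h1 := (leftAdm_semigroup hS hH hr hrs hsT hT (hα.trans hαγ).le hγβ
    (by linarith)).leftFrac_comp (α := α) hr (by linarith) hαγ
    (ContinuousLinearMap.compL ℝ V V V (S h - ContinuousLinearMap.id ℝ V))
  rw [ContinuousLinearMap.compL_apply] at h1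
  rw [convFrac, h1]
  refine ((leftAdm_increment hS hH hr hrs hsT hT (hα.trans hαγ).le hγβ
    (by linarith) hh).norm_leftFrac_le (α := α) hr (hrs.le.trans hsT) hT hα hαγ hγβ
    (by linarith)).trans_eq ?_
  ring

/-- The conditions on the two coefficients along a path. -/
structure KernelAdm (β ρ Λ T : ℝ) (f : ℝ → V) (H : ℝ → V →L[ℝ] V) : Prop where
  f_cont : ContinuousOn f (Ioc 0 T)
  f_bound : ∀ r ∈ Ioc 0 T, ‖f r‖ ≤ Λ * Real.exp (ρ * r)
  weight : WeightAdm β ρ Λ T H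

/-- The integrand of the mild formulation, including the drift. -/
def mildIntegrand (S : ℝ → V →L[ℝ] V) (α : ℝ) (ω : ℝ → V) (f : ℝ → V) (H : ℝ → V →L[ℝ] V)
    (t r : ℝ) : V :=
  S (t - r) (f r) - convFrac S α H t r (rightFrac α t ω r)

/-- The bounds serve, in order, for size, time increments and closeness to the image of `S h`.
Exponents add up as `-γ + (β' + α - 1) = β - 1 + 2θ` in the first, and to `2θ - 1` in the other two.
The drift is less singular and is absorbed with the constant `T * T`. The constant is chosen before
`ρ`, `Λ` and the coefficients, which allows `ρ` to be adjusted later. -/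
theorem exists_mildIntegrand_bounds [CompleteSpace V] (hS : SmoothingSemigroup S)
    {α β β' γ θ : ℝ} (hE : Exponents α β β' γ θ) {T M : ℝ} (hT : 1 ≤ T) {ω : ℝ → V}
    (hω : HolderPath β' M T ω) :
    ∃ C, 0 ≤ C ∧ ∀ ρ Λ f H, KernelAdm β ρ Λ T f H →
      (∀ r t, 0 < r → r < t → t ≤ T → ‖mildIntegrand S α ω f H t r‖ ≤
        C * ((Λ * Real.exp (ρ * r)) * (r ^ (-β) * (t - r) ^ (β - 1 + 2 * θ)))) ∧
      (∀ r s t, 0 < r → r < s → s ≤ t → t ≤ T →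
        ‖mildIntegrand S α ω f H t r - S (t - s) (mildIntegrand S α ω f H s r)‖ ≤
        C * ((Λ * Real.exp (ρ * r)) * (t - s) ^ β * (r ^ (-β) * (s - r) ^ (2 * θ - 1)))) ∧
      (∀ r s h, 0 < r → r < s → s ≤ T → 0 ≤ h →
        ‖S h (mildIntegrand S α ω f H s r) - mildIntegrand S α ω f H s r‖ ≤
        C * ((Λ * Real.exp (ρ * r)) * h ^ β * (r ^ (-β) * (s - r) ^ (2 * θ - 1)))) := by
  have hE' := hE
  obtain ⟨hα, hα', hαγ, hγβ, hββ', hβ', hθ, hθ0⟩ := hE'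
  have hL := leftConst_nonneg α β γ (zero_le_one.trans hT)
  have hM := hω.nonneg
  have hR : 0 ≤ rightConst α β β' := by
    have h1 : 0 < β' + α - 1 := by linarith
    have h2 : 0 < 1 - α - (β' - β) := by linarith
    have h3 : 0 < 1 - α := by linarith
    unfold rightConst
    positivity
  have hT0 : 0 < T := by linarith
  set c₁ := leftConst α β γ T * (2 * T * T)
  set c₂ := leftConst α β γ T * (8 * T * T)
  set R := rightConst α β β'
  have hc₁ : 0 ≤ c₁ := by positivity
  have hc₂ : 0 ≤ c₂ := by positivity
  refine ⟨T * T + (c₁ + c₂) * (R * M), by positivity, fun ρ Λ f H hK => ⟨?_, ?_, ?_⟩⟩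
  · intro r t hr hrt htT
    have htr : 0 < t - r := sub_pos.2 hrt
    have hΛ : 0 ≤ Λ * Real.exp (ρ * r) := mul_nonneg hK.weight.nonneg (Real.exp_pos _).le
    have hk : 0 ≤ r ^ (-β) * (t - r) ^ (β - 1 + 2 * θ) :=
      mul_nonneg (Real.rpow_nonneg hr.le _) (Real.rpow_nonneg htr.le _)
    have hF : ‖S (t - r) (f r)‖ ≤
        T * T * ((Λ * Real.exp (ρ * r)) * (r ^ (-β) * (t - r) ^ (β - 1 + 2 * θ))) := by
      have h1 : 1 ≤ T * r ^ (-β) :=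
        one_le_mul_rpow_neg hT hr (by linarith) (by linarith) (by linarith)
      have h2 : 1 ≤ T * (t - r) ^ (-(1 - β - 2 * θ)) :=
        one_le_mul_rpow_neg hT htr (by linarith) (by linarith) (by linarith)
      calc _ ≤ Λ * Real.exp (ρ * r) :=
            (hS.norm_apply_le htr.le _).trans (hK.f_bound r ⟨hr, by linarith⟩)
        _ ≤ Λ * Real.exp (ρ * r) * ((T * r ^ (-β)) * (T * (t - r) ^ (-(1 - β - 2 * θ)))) :=
            le_mul_of_one_le_right hΛ (one_le_mul_of_one_le_of_one_le h1 h2)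
        _ = _ := by
            rw [show -(1 - β - 2 * θ) = β - 1 + 2 * θ by ring]
            ring
    have hX : ‖convFrac S α H t r (rightFrac α t ω r)‖ ≤
        c₁ * (R * M) * ((Λ * Real.exp (ρ * r)) * (r ^ (-β) * (t - r) ^ (β - 1 + 2 * θ))) := by
      calc _ ≤ (c₁ * ((Λ * Real.exp (ρ * r)) * (r ^ (-β) * (t - r) ^ (-γ)))) *
            (R * (M * (t - r) ^ (β' + α - 1))) :=
            (convFrac S α H t r).le_of_opNorm_le_of_le
              (norm_convFrac_le hS hE hK.weight hT hr hrt htT)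
              (hω.norm_rightFrac_le hα' hβ' (by linarith) hββ' hr.le hrt htT)
        _ = _ := by
            rw [show β - 1 + 2 * θ = -γ + (β' + α - 1) by rw [hθ]; ring, Real.rpow_add htr]
            ring
    refine (norm_sub_le _ _).trans ((add_le_add hF hX).trans ?_)
    rw [← add_mul]
    have : 0 ≤ c₂ * (R * M) := by positivity
    exact mul_le_mul_of_nonneg_right (by linarith) (mul_nonneg hΛ hk)
  · intro r s t hr hrs hst htT
    have hsr : 0 < s - r := sub_pos.2 hrs
    have hΛ : 0 ≤ Λ * Real.exp (ρ * r) := mul_nonneg hK.weight.nonneg (Real.exp_pos _).le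
    have hts : 0 ≤ t - s := sub_nonneg.2 hst
    have hk : 0 ≤ r ^ (-β) * (s - r) ^ (2 * θ - 1) :=
      mul_nonneg (Real.rpow_nonneg hr.le _) (Real.rpow_nonneg hsr.le _)
    -- By the semigroup law the drift cancels, and by `convFrac_shift` only the change of endpoint
    -- in the derivative of `ω` remains.
    have e1 : mildIntegrand S α ω f H t r - S (t - s) (mildIntegrand S α ω f H s r) =
        -convFrac S α H t r (rightFrac α t ω r - rightFrac α s ω r) := by
      have h1 : S (t - r) = (S (t - s)).comp (S (s - r)) := by
        rw [← hS.map_add _ _ hts hsr.le]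
        congr 1
        ring
      simp only [mildIntegrand]
      rw [map_sub (convFrac S α H t r), map_sub (S (t - s)),
        convFrac_shift hS hE hK.weight hT hr hrs hst (hst.trans htT), h1]
      simp
    rw [e1, norm_neg]
    have h2 : (t - r) ^ (-γ) ≤ (s - r) ^ (-γ) :=
      Real.rpow_le_rpow_of_nonpos hsr (by linarith) (by linarith)
    have hrβ := Real.rpow_nonneg hr.le (-β)
    have htsβ := Real.rpow_nonneg hts β
    calc _ ≤ (c₁ * ((Λ * Real.exp (ρ * r)) * (r ^ (-β) * (t - r) ^ (-γ)))) *
          (R * (M * (t - s) ^ β * (s - r) ^ (α - 1 + (β' - β)))) :=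
          (convFrac S α H t r).le_of_opNorm_le_of_le
            (norm_convFrac_le hS hE hK.weight hT hr (hrs.trans_le hst) htT)
            (hω.norm_rightFrac_sub_le hα' hβ' (by linarith) hββ' hr.le hrs hst htT)
      _ ≤ (c₁ * ((Λ * Real.exp (ρ * r)) * (r ^ (-β) * (s - r) ^ (-γ)))) *
          (R * (M * (t - s) ^ β * (s - r) ^ (α - 1 + (β' - β)))) := by
          have := Real.rpow_nonneg hsr.le (α - 1 + (β' - β))
          gcongr
      _ = (c₁ * (R * M)) *
          ((Λ * Real.exp (ρ * r)) * (t - s) ^ β * (r ^ (-β) * (s - r) ^ (2 * θ - 1))) := by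
          have : (s - r) ^ (2 * θ - 1) = (s - r) ^ (-γ) * (s - r) ^ (α - 1 + (β' - β)) := by
            rw [← Real.rpow_add hsr, hθ]
            ring_nf
          rw [this]
          ring
      _ ≤ _ := by
          have : 0 ≤ c₂ * (R * M) := by positivity
          have : 0 ≤ T * T := by positivity
          exact mul_le_mul_of_nonneg_right (by linarith) (by positivity)
  · intro r s h hr hrs hsT hh
    have hsr : 0 < s - r := sub_pos.2 hrs
    have hΛ : 0 ≤ Λ * Real.exp (ρ * r) := mul_nonneg hK.weight.nonneg (Real.exp_pos _).le
    have hrβ := Real.rpow_nonneg hr.le (-β)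
    have hhβ := Real.rpow_nonneg hh β
    have hsθ := Real.rpow_nonneg hsr.le (2 * θ - 1)
    have e1 : S h (mildIntegrand S α ω f H s r) - mildIntegrand S α ω f H s r =
        ((S h - ContinuousLinearMap.id ℝ V).comp (S (s - r))) (f r) -
        ((S h - ContinuousLinearMap.id ℝ V).comp (convFrac S α H s r)) (rightFrac α s ω r) := by
      simp only [mildIntegrand, map_sub, ContinuousLinearMap.comp_apply, _root_.sub_apply,
        ContinuousLinearMap.id_apply]
      abel
    have hF : ‖((S h - ContinuousLinearMap.id ℝ V).comp (S (s - r))) (f r)‖ ≤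
        T * T * ((Λ * Real.exp (ρ * r)) * h ^ β * (r ^ (-β) * (s - r) ^ (2 * θ - 1))) := by
      have h1 : 1 ≤ T * r ^ (-β) :=
        one_le_mul_rpow_neg hT hr (by linarith) (by linarith) (by linarith)
      have h2 : (s - r) ^ (1 - 2 * θ - β) ≤ T :=
        rpow_le_self_of_one_le hsr.le (by linarith) hT (by linarith) (by linarith)
      calc _ ≤ (h ^ β * (s - r) ^ (-β)) * (Λ * Real.exp (ρ * r)) :=
            ContinuousLinearMap.le_of_opNorm_le_of_le _
              (hS.norm_increment_le hh hsr (by linarith) (by linarith))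
              (hK.f_bound r ⟨hr, by linarith⟩)
        _ = (h ^ β * ((s - r) ^ (1 - 2 * θ - β) * (s - r) ^ (2 * θ - 1))) *
            (Λ * Real.exp (ρ * r)) := by
            rw [← Real.rpow_add hsr]
            ring_nf
        _ ≤ (h ^ β * (T * (s - r) ^ (2 * θ - 1))) * (Λ * Real.exp (ρ * r)) * (T * r ^ (-β)) := by
            refine le_trans ?_ (le_mul_of_one_le_right (by positivity) h1)
            gcongr
        _ = _ := by ring
    have hX : ‖((S h - ContinuousLinearMap.id ℝ V).comp (convFrac S α H s r))
        (rightFrac α s ω r)‖ ≤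
        c₂ * (R * M) * ((Λ * Real.exp (ρ * r)) * h ^ β * (r ^ (-β) * (s - r) ^ (2 * θ - 1))) := by
      calc _ ≤ (c₂ * ((Λ * Real.exp (ρ * r)) * h ^ β * (r ^ (-β) * (s - r) ^ (-β - γ)))) *
            (R * (M * (s - r) ^ (β' + α - 1))) :=
            ContinuousLinearMap.le_of_opNorm_le_of_le _
              (norm_increment_convFrac_le hS hE hK.weight hT hr hrs hsT hh)
              (hω.norm_rightFrac_le hα' hβ' (by linarith) hββ' hr.le hrs hsT)
        _ = _ := by
            rw [show 2 * θ - 1 = (-β - γ) + (β' + α - 1) by rw [hθ]; ring, Real.rpow_add hsr]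
            ring
    rw [e1]
    refine (norm_sub_le _ _).trans ((add_le_add hF hX).trans ?_)
    rw [← add_mul]
    have : 0 ≤ c₁ * (R * M) := by positivity
    exact mul_le_mul_of_nonneg_right (by linarith) (by positivity)

end Integrand

/-! ### Integrability of the mild integrand and identification of the pathwise integral -/

section Convolution

variable {V : Type*} [NormedAddCommGroup V] [InnerProductSpace ℝ V]

variable {S : ℝ → V →L[ℝ] V} {α β β' γ θ ρ Λ T M : ℝ} {ω : ℝ → V} {f : ℝ → V}
  {H : ℝ → V →L[ℝ] V}

theorem aestronglyMeasurable_clm_apply {X : Type*} [MeasurableSpace X] {μ : Measure X}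
    {B : X → V →L[ℝ] V} {w : X → V} (hB : AEStronglyMeasurable B μ)
    (hw : AEStronglyMeasurable w μ) : AEStronglyMeasurable (fun x => B x (w x)) μ :=
  isBoundedBilinearMap_apply.continuous.comp_aestronglyMeasurable (hB.prodMk hw)

theorem aestronglyMeasurable_convFrac (hS : SmoothingSemigroup S) (hH : WeightAdm β ρ Λ T H)
    {t : ℝ} (htT : t ≤ T) :
    AEStronglyMeasurable (fun r => convFrac S α H t r) (volume.restrict (Ioo 0 t)) :=
  aestronglyMeasurable_leftFrac α ((hS.continuousOn_sub le_rfl).clm_comp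
    (hH.cont.mono fun _ hq => ⟨hq.1, hq.2.le.trans htT⟩))

theorem aestronglyMeasurable_mildIntegrand (hS : SmoothingSemigroup S)
    (hK : KernelAdm β ρ Λ T f H) (hω : Continuous ω) {t : ℝ} (htT : t ≤ T) :
    AEStronglyMeasurable (mildIntegrand S α ω f H t) (volume.restrict (Ioo 0 t)) := by
  refine AEStronglyMeasurable.sub ?_ ?_
  · refine ContinuousOn.aestronglyMeasurable ?_ measurableSet_Ioo
    exact (hS.continuousOn_sub le_rfl).clm_apply
      (hK.f_cont.mono fun _ hq => ⟨hq.1, hq.2.le.trans htT⟩)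
  · exact aestronglyMeasurable_clm_apply (aestronglyMeasurable_convFrac hS hK.weight htT)
      (aestronglyMeasurable_rightFrac α hω)

theorem KernelAdm.nonneg (hK : KernelAdm β ρ Λ T f H) : 0 ≤ Λ := hK.weight.nonneg

/-- Putting the drift to zero lets statements about `mildIntegrand` be reused for its stochastic
part alone. -/
theorem KernelAdm.zero_left (hK : KernelAdm β ρ Λ T f H) :
    KernelAdm β ρ Λ T (fun _ => (0 : V)) H :=
  ⟨continuousOn_const, fun r _ => by
    simpa using mul_nonneg hK.nonneg (Real.exp_pos _).le, hK.weight⟩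

variable [CompleteSpace V]

theorem exists_norm_mildIntegrand_le (hS : SmoothingSemigroup S) (hE : Exponents α β β' γ θ)
    (hT : 1 ≤ T) (hω : HolderPath β' M T ω) (hρ : 0 ≤ ρ) (Λ : ℝ) :
    ∃ C, 0 ≤ C ∧ ∀ f H, KernelAdm β ρ Λ T f H → ∀ r t, 0 < r → r < t → t ≤ T →
      ‖mildIntegrand S α ω f H t r‖ ≤ C * (r ^ (-β) * (t - r) ^ (β - 1 + 2 * θ)) := by
  obtain ⟨C, hC, h⟩ := exists_mildIntegrand_bounds hS hE hT hω
  refine ⟨C * (|Λ| * Real.exp (ρ * T)), by positivity, fun f H hK r t hr hrt htT => ?_⟩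
  refine ((h ρ Λ f H hK).1 r t hr hrt htT).trans ?_
  have h1 : 0 ≤ r ^ (-β) * (t - r) ^ (β - 1 + 2 * θ) :=
    mul_nonneg (Real.rpow_nonneg hr.le _) (Real.rpow_nonneg (sub_pos.2 hrt).le _)
  have h2 : Λ ≤ |Λ| := le_abs_self _
  have h3 : Real.exp (ρ * r) ≤ Real.exp (ρ * T) := by
    gcongr
    linarith
  rw [mul_assoc C]
  gcongr

theorem intervalIntegrable_of_kernel_bound {g : ℝ → V} {a b C t : ℝ} (ht : 0 < t) (ha : -1 < a)
    (hb : -1 < b) (hg : AEStronglyMeasurable g (volume.restrict (Ioo 0 t)))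
    (hC : ∀ r ∈ Ioo 0 t, ‖g r‖ ≤ C * (r ^ a * (t - r) ^ b)) :
    IntervalIntegrable g volume 0 t := by
  have h := (intervalIntegrable_rpow_mul_sub_rpow ha hb ht).const_mul C
  rw [intervalIntegrable_iff_integrableOn_Ioo_of_le ht.le] at h ⊢
  exact Integrable.mono' h hg ((ae_restrict_iff' measurableSet_Ioo).2 (ae_of_all _ hC))

theorem intervalIntegrable_mildIntegrand (hS : SmoothingSemigroup S) (hE : Exponents α β β' γ θ)
    (hT : 1 ≤ T) (hω : HolderPath β' M T ω) (hρ : 0 ≤ ρ) (hK : KernelAdm β ρ Λ T f H) {t : ℝ}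
    (ht : 0 < t) (htT : t ≤ T) :
    IntervalIntegrable (mildIntegrand S α ω f H t) volume 0 t := by
  obtain ⟨C, -, hC⟩ := exists_norm_mildIntegrand_le hS hE hT hω hρ Λ
  obtain ⟨hα, hα', hαγ, hγβ, hββ', hβ', hθ, hθ0⟩ := hE
  exact intervalIntegrable_of_kernel_bound ht (by linarith) (by linarith)
    (aestronglyMeasurable_mildIntegrand hS hK hω.cont htT)
    fun r hr => hC f H hK r t hr.1 hr.2 htT

theorem intervalIntegrable_convFrac_apply (hS : SmoothingSemigroup S)
    (hE : Exponents α β β' γ θ) (hT : 1 ≤ T) (hω : HolderPath β' M T ω) (hρ : 0 ≤ ρ)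
    (hK : KernelAdm β ρ Λ T f H) {t : ℝ} (ht : 0 < t) (htT : t ≤ T) :
    IntervalIntegrable (fun r => convFrac S α H t r (rightFrac α t ω r)) volume 0 t := by
  have h := (intervalIntegrable_mildIntegrand hS hE hT hω hρ hK.zero_left ht htT).neg
  refine h.congr fun r _ => ?_
  simp [mildIntegrand]

theorem integral_mildIntegrand (hS : SmoothingSemigroup S) (hE : Exponents α β β' γ θ)
    (hT : 1 ≤ T) (hω : HolderPath β' M T ω) (hρ : 0 ≤ ρ) (hK : KernelAdm β ρ Λ T f H) {t : ℝ}
    (ht : 0 < t) (htT : t ≤ T) :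
    ∫ r in (0 : ℝ)..t, mildIntegrand S α ω f H t r =
      (∫ r in (0 : ℝ)..t, S (t - r) (f r)) -
        ∫ r in (0 : ℝ)..t, convFrac S α H t r (rightFrac α t ω r) := by
  have h1 := intervalIntegrable_mildIntegrand hS hE hT hω hρ hK ht htT
  have h2 := intervalIntegrable_convFrac_apply hS hE hT hω hρ hK ht htT
  have h3 : IntervalIntegrable (fun r => S (t - r) (f r)) volume 0 t := by
    refine (h1.add h2).congr fun r _ => ?_
    simp [mildIntegrand]
  exact intervalIntegral.integral_sub h3 h2

/-- Cauchy–Schwarz followed by Bessel. The bound does not depend on the finite set, so it dominates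
all partial sums of the Parseval series at once. -/
theorem abs_sum_inner_mul_inner_le {ι : Type*} {v : ι → V} (hv : Orthonormal ℝ v) (x y : V)
    (s : Finset ι) : |∑ i ∈ s, ⟪x, v i⟫ * ⟪v i, y⟫| ≤ ‖x‖ * ‖y‖ := by
  have hb : ∀ z : V, √(∑ i ∈ s, |⟪v i, z⟫| ^ 2) ≤ ‖z‖ := fun z =>
    Real.sqrt_le_iff.2 ⟨norm_nonneg _, by
      simpa using hv.sum_inner_products_le z (s := s)⟩
  calc _ ≤ ∑ i ∈ s, |⟪v i, x⟫| * |⟪v i, y⟫| := by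
        refine (Finset.abs_sum_le_sum_abs _ _).trans_eq (Finset.sum_congr rfl fun i _ => ?_)
        rw [abs_mul, real_inner_comm]
    _ ≤ √(∑ i ∈ s, |⟪v i, x⟫| ^ 2) * √(∑ i ∈ s, |⟪v i, y⟫| ^ 2) :=
        Real.sum_mul_le_sqrt_mul_sqrt _ _ _
    _ ≤ _ := mul_le_mul (hb x) (hb y) (Real.sqrt_nonneg _) (norm_nonneg _)

/-- For fixed `j`, the sum over `i` is Parseval's identity for the pairing of the adjoint of
`convFrac` at `e j` with the derivative of `ω`, exchanged with the integral by dominated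
convergence. The sum over `j` is then the basis expansion of the Bochner integral. -/
theorem pathwiseIntegral_eq {ι : Type*} [Countable ι] (e : HilbertBasis ι ℝ V)
    (hS : SmoothingSemigroup S) (hE : Exponents α β β' γ θ)
    (hT : 1 ≤ T) (hω : HolderPath β' M T ω) (hρ : 0 ≤ ρ) (hK : KernelAdm β ρ Λ T f H) {t : ℝ}
    (ht : 0 < t) (htT : t ≤ T) :
    pathwiseIntegral e α 0 t (fun r => (S (t - r)).comp (H r)) ω =
      -∫ r in (0 : ℝ)..t, convFrac S α H t r (rightFrac α t ω r) := by
  have hint := intervalIntegrable_convFrac_apply hS hE hT hω hρ hK ht htT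
  have hA := aestronglyMeasurable_convFrac (α := α) hS hK.weight htT
  have hw := aestronglyMeasurable_rightFrac α (t := t) hω.cont
  have hE' := hE
  obtain ⟨hα, hα', hαγ, hγβ, hββ', hβ', hθ, hθ0⟩ := hE'
  set I := ∫ r in (0 : ℝ)..t, convFrac S α H t r (rightFrac α t ω r) with hI
  have hcoord : ∀ i j, ∀ r ∈ Ioo 0 t,
      leftFracDeriv α 0 (fun q => ⟪e j, (S (t - q)).comp (H q) (e i)⟫) r *
        rightFracDeriv α t (fun q => ⟪e i, ω q⟫) r =
      ⟪(convFrac S α H t r).adjoint (e j), e i⟫ * ⟪e i, rightFrac α t ω r⟫ := by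
    intro i j r hr
    have h1 := (leftAdm_semigroup hS hK.weight hr.1 hr.2 htT hT (hα.trans hαγ).le hγβ
      (by linarith)).leftFrac_comp (α := α) hr.1 (by linarith) hαγ
      ((innerSL ℝ (e j)).comp (ContinuousLinearMap.apply ℝ V (e i)))
    have h2 := hω.rightFrac_comp hα' hr.1.le hr.2.le htT (innerSL ℝ (e i))
    rw [leftFracDeriv_eq_leftFrac, rightFracDeriv_eq_rightFrac]
    simp only [ContinuousLinearMap.comp_apply, innerSL_apply_apply,
      ContinuousLinearMap.apply_apply] at h1 h2 ⊢
    rw [← h1, ← h2, ContinuousLinearMap.adjoint_inner_left]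
    rfl
  have hsum : ∀ j, HasSum (fun i => ∫ r in (0 : ℝ)..t,
      leftFracDeriv α 0 (fun q => ⟪e j, (S (t - q)).comp (H q) (e i)⟫) r *
        rightFracDeriv α t (fun q => ⟪e i, ω q⟫) r) ⟪e j, I⟫ := by
    intro j
    have hadj : AEStronglyMeasurable (fun r => (convFrac S α H t r).adjoint (e j))
        (volume.restrict (Ioo 0 t)) :=
      ((ContinuousLinearMap.adjoint (𝕜 := ℝ) (E := V) (F := V)).continuous.comp_aestronglyMeasurable
        hA).apply_continuousLinearMap (e j)
    have hIj : ⟪e j, I⟫ = ∫ r in Ioo 0 t,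
        ⟪(convFrac S α H t r).adjoint (e j), rightFrac α t ω r⟫ := by
      have := (innerSL ℝ (e j)).intervalIntegral_comp_comm hint
      simp only [innerSL_apply_apply] at this
      rw [hI, ← this, intervalIntegral.integral_of_le ht.le, integral_Ioc_eq_integral_Ioo]
      simp only [ContinuousLinearMap.adjoint_inner_left]
    have hIi : ∀ i, ∫ r in (0 : ℝ)..t,
        leftFracDeriv α 0 (fun q => ⟪e j, (S (t - q)).comp (H q) (e i)⟫) r *
        rightFracDeriv α t (fun q => ⟪e i, ω q⟫) r = ∫ r in Ioo 0 t,
        ⟪(convFrac S α H t r).adjoint (e j), e i⟫ * ⟪e i, rightFrac α t ω r⟫ := by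
      intro i
      rw [intervalIntegral.integral_of_le ht.le, integral_Ioc_eq_integral_Ioo]
      exact setIntegral_congr_fun measurableSet_Ioo fun r hr => hcoord i j r hr
    simp only [hIi, hIj]
    obtain ⟨C₂, hC₂, hw'⟩ : ∃ C₂, 0 ≤ C₂ ∧ ∀ r ∈ Ioo 0 t,
        ‖rightFrac α t ω r‖ ≤ C₂ * (M * (t - r) ^ (β' + α - 1)) :=
      ⟨|rightConst α β β'|, abs_nonneg _, fun r hr =>
        (hω.norm_rightFrac_le hα' hβ' (by linarith) hββ' hr.1.le hr.2 htT).trans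
          (mul_le_mul_of_nonneg_right (le_abs_self _)
            (mul_nonneg hω.nonneg (Real.rpow_nonneg (sub_pos.2 hr.2).le _)))⟩
    set c := leftConst α β γ T * (2 * T * T) with hc
    have hc0 : 0 ≤ c := by
      have := leftConst_nonneg α β γ (zero_le_one.trans hT)
      positivity
    have hbound : ∀ r ∈ Ioo 0 t,
        ‖(convFrac S α H t r).adjoint (e j)‖ * ‖rightFrac α t ω r‖ ≤
        c * Λ * Real.exp (ρ * T) * C₂ * M * (r ^ (-β) * (t - r) ^ (β - 1 + 2 * θ)) := by
      intro r hr
      have htr : 0 < t - r := sub_pos.2 hr.2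
      have hΛ := hK.nonneg
      have hM := hω.nonneg
      have h1 : ‖(convFrac S α H t r).adjoint (e j)‖ ≤
          c * ((Λ * Real.exp (ρ * r)) * (r ^ (-β) * (t - r) ^ (-γ))) := by
        refine ((convFrac S α H t r).adjoint.le_opNorm (e j)).trans ?_
        rw [e.orthonormal.1 j, mul_one, LinearIsometryEquiv.norm_map]
        exact norm_convFrac_le hS hE hK.weight hT hr.1 hr.2 htT
      have hr0 := Real.rpow_nonneg hr.1.le (-β)
      have hr1 := Real.rpow_nonneg htr.le (-γ)
      have hr2 := Real.rpow_nonneg htr.le (β' + α - 1)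
      have h3 : Real.exp (ρ * r) ≤ Real.exp (ρ * T) := by
        have := hr.2
        gcongr
        linarith
      calc _ ≤ (c * ((Λ * Real.exp (ρ * r)) * (r ^ (-β) * (t - r) ^ (-γ)))) *
            (C₂ * (M * (t - r) ^ (β' + α - 1))) :=
            mul_le_mul h1 (hw' r hr) (norm_nonneg _) (by positivity)
        _ ≤ (c * ((Λ * Real.exp (ρ * T)) * (r ^ (-β) * (t - r) ^ (-γ)))) *
            (C₂ * (M * (t - r) ^ (β' + α - 1))) := by gcongr
        _ = _ := by
            have : (t - r) ^ (β - 1 + 2 * θ) = (t - r) ^ (-γ) * (t - r) ^ (β' + α - 1) := by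
              rw [← Real.rpow_add htr, hθ]
              ring_nf
            rw [this]
            ring
    have hmeas : ∀ i, AEStronglyMeasurable (fun r =>
        ⟪(convFrac S α H t r).adjoint (e j), e i⟫ * ⟪e i, rightFrac α t ω r⟫)
        (volume.restrict (Ioo 0 t)) := fun i =>
      (hadj.inner aestronglyMeasurable_const).mul (aestronglyMeasurable_const.inner hw)
    have hbi := (intervalIntegrable_rpow_mul_sub_rpow (a := -β) (b := β - 1 + 2 * θ)
      (by linarith) (by linarith) ht).const_mul (c * Λ * Real.exp (ρ * T) * C₂ * M)
    rw [intervalIntegrable_iff_integrableOn_Ioo_of_le ht.le] at hbi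
    have hle : ∀ s : Finset ι, ∀ r ∈ Ioo 0 t,
        ‖∑ i ∈ s, ⟪(convFrac S α H t r).adjoint (e j), e i⟫ * ⟪e i, rightFrac α t ω r⟫‖ ≤
        c * Λ * Real.exp (ρ * T) * C₂ * M * (r ^ (-β) * (t - r) ^ (β - 1 + 2 * θ)) :=
      fun s r hr => (abs_sum_inner_mul_inner_le e.orthonormal _ _ s).trans (hbound r hr)
    have hmi : ∀ i, IntegrableOn (fun r =>
        ⟪(convFrac S α H t r).adjoint (e j), e i⟫ * ⟪e i, rightFrac α t ω r⟫) (Ioo 0 t) := by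
      intro i
      refine Integrable.mono' hbi (hmeas i)
        ((ae_restrict_iff' measurableSet_Ioo).2 (ae_of_all _ fun r hr => ?_))
      simpa using hle {i} r hr
    rw [HasSum]
    simp only [SummationFilter.unconditional_filter]
    simp_rw [← integral_finsetSum _ fun i _ => hmi i]
    -- Dominated convergence runs along the net of finite index sets, whose filter is countably
    -- generated because `ι` is countable.
    refine tendsto_integral_filter_of_dominated_convergence _
      (Eventually.of_forall fun s => ?_)
      (Eventually.of_forall fun s => (ae_restrict_iff' measurableSet_Ioo).2
        (ae_of_all _ fun r hr => hle s r hr)) hbi (ae_of_all _ fun r => ?_)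
    · exact Finset.aestronglyMeasurable_fun_sum s fun i _ => hmeas i
    · exact e.hasSum_inner_mul_inner _ _
  rw [pathwiseIntegral]
  congr 1
  have h := (e.hasSum_repr I).tsum_eq
  simp only [e.repr_apply_apply] at h
  rw [← h]
  exact tsum_congr fun j => by rw [(hsum j).tsum_eq]

end Convolution

/-! ### Weighted estimates and continuity of the mild convolution -/

section Estimates

variable {V : Type*} [NormedAddCommGroup V] [InnerProductSpace ℝ V]

theorem ae_mem_Ioo_of_mem_Ioc (s t : ℝ) : ∀ᵐ r : ℝ, r ∈ Ioc s t → r ∈ Ioo s t := by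
  have h : ∀ᵐ r : ℝ, r ≠ t := by simp [ae_iff]
  filter_upwards [h] with r hr hrt
  exact ⟨hrt.1, lt_of_le_of_ne hrt.2 hr⟩

/-- The weight `exp (ρ r)` is converted to `exp (ρ t) ρ ^ (-θ)` at the cost of lowering the exponent
`b` by `θ`; a beta integral remains. -/
theorem norm_integral_le_of_weight {g : ℝ → V} {a b θ ρ K t : ℝ} (ht : 0 < t) (hρ : 0 < ρ)
    (hθ : 0 ≤ θ) (hθ1 : θ ≤ 1) (ha : -1 < a) (hb : -1 < b - θ) (hK : 0 ≤ K)
    (hg : ∀ r ∈ Ioo 0 t, ‖g r‖ ≤ K * (Real.exp (ρ * r) * (r ^ a * (t - r) ^ b))) :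
    ‖∫ r in (0 : ℝ)..t, g r‖ ≤
      K * (Real.exp (ρ * t) * ρ ^ (-θ)) * (betaConst a (b - θ) * t ^ (a + (b - θ) + 1)) := by
  rw [← integral_rpow_mul_sub_rpow _ _ ht, ← intervalIntegral.integral_const_mul]
  refine intervalIntegral.norm_integral_le_of_norm_le ht.le ?_
    ((intervalIntegrable_rpow_mul_sub_rpow ha hb ht).const_mul _)
  filter_upwards [ae_mem_Ioo_of_mem_Ioc 0 t] with r hr hrt
  have hr := hr hrt
  have htr : 0 < t - r := sub_pos.2 hr.2
  have h1 := exp_mul_le_rpow hρ hr.2 hθ hθ1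
  have h2 := Real.rpow_nonneg hr.1.le a
  have h3 := Real.rpow_nonneg htr.le b
  calc _ ≤ K * (Real.exp (ρ * r) * (r ^ a * (t - r) ^ b)) := hg r hr
    _ ≤ K * ((Real.exp (ρ * t) * ρ ^ (-θ) * (t - r) ^ (-θ)) * (r ^ a * (t - r) ^ b)) := by gcongr
    _ = _ := by
        rw [show b - θ = -θ + b by ring, Real.rpow_add htr]
        ring

variable {S : ℝ → V →L[ℝ] V} {α β β' γ θ ρ Λ T M : ℝ} {ω : ℝ → V} {f : ℝ → V}
  {H : ℝ → V →L[ℝ] V} [CompleteSpace V]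

/-- The convolution part of the mild formulation. -/
def mildIntegral (S : ℝ → V →L[ℝ] V) (α : ℝ) (ω : ℝ → V) (f : ℝ → V) (H : ℝ → V →L[ℝ] V)
    (t : ℝ) : V :=
  ∫ r in (0 : ℝ)..t, mildIntegrand S α ω f H t r

/-- The first two bounds feed the a priori estimate. The power `t ^ θ` also gives continuity of
limits at time zero. The third bound is the source of compactness, and with `h = t - s` it completes
the comparison of the values at `s` and `t`. -/
theorem exists_mildIntegral_bounds (hS : SmoothingSemigroup S) (hE : Exponents α β β' γ θ)
    (hT : 1 ≤ T) (hω : HolderPath β' M T ω) :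
    ∃ C, 0 ≤ C ∧ ∀ ρ Λ f H, 0 < ρ → KernelAdm β ρ Λ T f H →
      (∀ t ∈ Ioc 0 T, ‖mildIntegral S α ω f H t‖ ≤
        C * (Λ * (Real.exp (ρ * t) * ρ ^ (-θ))) * t ^ θ) ∧
      (∀ s t, 0 < s → s ≤ t → t ≤ T → ‖mildIntegral S α ω f H t - mildIntegral S α ω f H s‖ ≤
        C * (Λ * (Real.exp (ρ * t) * ρ ^ (-θ))) * (s ^ (-β) * (t - s) ^ β)) ∧
      (∀ s h, 0 < s → s ≤ T → 0 ≤ h →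
        ‖S h (mildIntegral S α ω f H s) - mildIntegral S α ω f H s‖ ≤
        C * (Λ * (Real.exp (ρ * s) * ρ ^ (-θ))) * (s ^ (-β) * h ^ β)) := by
  obtain ⟨C, hC, hB⟩ := exists_mildIntegrand_bounds hS hE hT hω
  have hE' := hE
  obtain ⟨hα, hα', hαγ, hγβ, hββ', hβ', hθ, hθ0⟩ := hE'
  have hT0 : 0 < T := by linarith
  set B₁ := betaConst (-β) (β - 1 + 2 * θ - θ)
  set B₂ := betaConst (-β) (2 * θ - 1 - θ)
  have hB₁ : 0 ≤ B₁ := betaConst_nonneg _ _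
  have hB₂ : 0 ≤ B₂ := betaConst_nonneg _ _
  have hβθ : 0 < β + θ := by linarith
  have hK₂ : 0 ≤ C * (T / (β + θ)) := by positivity
  have main : ∀ ρ Λ f H, 0 < ρ → KernelAdm β ρ Λ T f H →
      (∀ t ∈ Ioc 0 T, ‖mildIntegral S α ω f H t‖ ≤
        (C * B₁) * (Λ * (Real.exp (ρ * t) * ρ ^ (-θ))) * t ^ θ) ∧
      (∀ s t, 0 < s → s ≤ t → t ≤ T →
        ‖mildIntegral S α ω f H t - S (t - s) (mildIntegral S α ω f H s)‖ ≤
        (C * (T / (β + θ)) + C * B₂ * T) * (Λ * (Real.exp (ρ * t) * ρ ^ (-θ))) *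
          (s ^ (-β) * (t - s) ^ β)) ∧
      (∀ s h, 0 < s → s ≤ T → 0 ≤ h →
        ‖S h (mildIntegral S α ω f H s) - mildIntegral S α ω f H s‖ ≤
        (C * B₂ * T) * (Λ * (Real.exp (ρ * s) * ρ ^ (-θ))) * (s ^ (-β) * h ^ β)) := by
    intro ρ Λ f H hρ hK
    obtain ⟨h1, h2, h3⟩ := hB ρ Λ f H hK
    have hΛ := hK.nonneg
    have hint : ∀ t, 0 < t → t ≤ T → IntervalIntegrable (mildIntegrand S α ω f H t) volume 0 t :=
      fun t ht htT => intervalIntegrable_mildIntegrand hS hE hT hω hρ.le hK ht htT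
    have hpow : ∀ s, 0 < s → s ≤ T → s ^ (-β + (2 * θ - 1 - θ) + 1) ≤ T * s ^ (-β) := by
      intro s hs hsT
      rw [show -β + (2 * θ - 1 - θ) + 1 = θ + -β by ring, Real.rpow_add hs]
      have := rpow_le_self_of_one_le hs.le hsT hT hθ0.le (by linarith)
      gcongr
    refine ⟨fun t ht => ?_, fun s t hs hst htT => ?_, fun s h hs hsT hh => ?_⟩
    · have := norm_integral_le_of_weight (g := mildIntegrand S α ω f H t) (a := -β)
        (b := β - 1 + 2 * θ) (θ := θ) (ρ := ρ) (K := C * Λ) ht.1 hρ hθ0.le (by linarith)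
        (by linarith) (by linarith) (by positivity) (fun r hr =>
          (h1 r t hr.1 hr.2 ht.2).trans_eq (by ring))
      refine this.trans_eq ?_
      rw [show -β + (β - 1 + 2 * θ - θ) + 1 = θ by ring]
      ring
    · have hs0 := Real.rpow_nonneg hs.le (-β)
      have hts : 0 ≤ t - s := sub_nonneg.2 hst
      have htsβ := Real.rpow_nonneg hts β
      have hi := hint t (hs.trans_le hst) htT
      have his : IntervalIntegrable (mildIntegrand S α ω f H t) volume 0 s :=
        hi.mono_set (by
          rw [uIcc_of_le hs.le, uIcc_of_le (hs.le.trans hst)]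
          exact Icc_subset_Icc_right hst)
      have hist : IntervalIntegrable (mildIntegrand S α ω f H t) volume s t := his.symm.trans hi
      have hi2 : IntervalIntegrable (fun r => S (t - s) (mildIntegrand S α ω f H s r))
          volume 0 s := by
        have := hint s hs (hst.trans htT)
        exact ⟨(S (t - s)).integrable_comp this.1, (S (t - s)).integrable_comp this.2⟩
      -- The new part over `[s, t]` is small by size; over `[0, s]` the increment bound of the
      -- integrand applies.
      have e1 : mildIntegral S α ω f H t - S (t - s) (mildIntegral S α ω f H s) =
          (∫ r in s..t, mildIntegrand S α ω f H t r) + ∫ r in (0 : ℝ)..s,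
          (mildIntegrand S α ω f H t r - S (t - s) (mildIntegrand S α ω f H s r)) := by
        rw [intervalIntegral.integral_sub his hi2,
          (S (t - s)).intervalIntegral_comp_comm (hint s hs (hst.trans htT)), mildIntegral,
          mildIntegral, ← intervalIntegral.integral_add_adjacent_intervals his hist]
        abel
      -- Here `r ≥ s`, so `r ^ (-β)` is frozen at `s ^ (-β)` and only the singularity at `t` is
      -- integrated.
      have e2 : ‖∫ r in s..t, mildIntegrand S α ω f H t r‖ ≤
          C * (T / (β + θ)) * (Λ * (Real.exp (ρ * t) * ρ ^ (-θ))) * (s ^ (-β) * (t - s) ^ β) := by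
        have hI : IntervalIntegrable (fun r => (t - r) ^ (β - 1 + θ)) volume s t := by
          have := (intervalIntegral.intervalIntegrable_rpow' (a := t - s) (b := 0)
            (r := β - 1 + θ) (by linarith)).comp_sub_left t
          simpa using this
        have hv : ∫ r in s..t, (t - r) ^ (β - 1 + θ) = (t - s) ^ (β + θ) / (β + θ) := by
          rw [intervalIntegral.integral_comp_sub_left (fun x => x ^ (β - 1 + θ)),
            integral_rpow (Or.inl (by linarith)), sub_self, show β - 1 + θ + 1 = β + θ by ring,
            Real.zero_rpow (by linarith), sub_zero]
        calc _ ≤ ∫ r in s..t, (C * (Λ * (Real.exp (ρ * t) * ρ ^ (-θ))) * s ^ (-β)) *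
              (t - r) ^ (β - 1 + θ) := by
              refine intervalIntegral.norm_integral_le_of_norm_le hst ?_ (hI.const_mul _)
              filter_upwards [ae_mem_Ioo_of_mem_Ioc s t] with r hr hrt
              have hr := hr hrt
              have hr0 : 0 < r := hs.trans hr.1
              have htr : 0 < t - r := sub_pos.2 hr.2
              have e3 : Real.exp (ρ * r) ≤ Real.exp (ρ * t) * ρ ^ (-θ) * (t - r) ^ (-θ) :=
                exp_mul_le_rpow hρ hr.2 hθ0.le (by linarith)
              have e4 : r ^ (-β) ≤ s ^ (-β) :=
                Real.rpow_le_rpow_of_nonpos hs hr.1.le (by linarith)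
              have e5 := Real.rpow_nonneg htr.le (β - 1 + 2 * θ)
              have e6 := Real.rpow_nonneg hr0.le (-β)
              have e7 := Real.rpow_nonneg htr.le (-θ)
              have e8 := Real.rpow_nonneg hρ.le (-θ)
              calc _ ≤ C * ((Λ * Real.exp (ρ * r)) * (r ^ (-β) * (t - r) ^ (β - 1 + 2 * θ))) :=
                    h1 r t hr0 hr.2 htT
                _ ≤ C * ((Λ * (Real.exp (ρ * t) * ρ ^ (-θ) * (t - r) ^ (-θ))) *
                    (s ^ (-β) * (t - r) ^ (β - 1 + 2 * θ))) := by gcongr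
                _ = _ := by
                    have : (t - r) ^ (β - 1 + θ) = (t - r) ^ (-θ) * (t - r) ^ (β - 1 + 2 * θ) := by
                      rw [← Real.rpow_add htr]
                      ring_nf
                    rw [this]
                    ring
          _ = C * (Λ * (Real.exp (ρ * t) * ρ ^ (-θ))) * s ^ (-β) *
              ((t - s) ^ β * (t - s) ^ θ / (β + θ)) := by
              rw [intervalIntegral.integral_const_mul, hv, Real.rpow_add' hts (by linarith)]
          _ ≤ C * (Λ * (Real.exp (ρ * t) * ρ ^ (-θ))) * s ^ (-β) *
              ((t - s) ^ β * T / (β + θ)) := by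
              have := rpow_le_self_of_one_le hts (by linarith) hT hθ0.le (by linarith)
              gcongr
          _ = _ := by ring
      have e3 : ‖∫ r in (0 : ℝ)..s,
          (mildIntegrand S α ω f H t r - S (t - s) (mildIntegrand S α ω f H s r))‖ ≤
          C * B₂ * T * (Λ * (Real.exp (ρ * t) * ρ ^ (-θ))) * (s ^ (-β) * (t - s) ^ β) := by
        have := norm_integral_le_of_weight (g := fun r => mildIntegrand S α ω f H t r -
          S (t - s) (mildIntegrand S α ω f H s r)) (a := -β)
          (b := 2 * θ - 1) (θ := θ) (ρ := ρ) (K := C * Λ * (t - s) ^ β) hs hρ hθ0.le (by linarith)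
          (by linarith) (by linarith) (by positivity) (fun r hr =>
            (h2 r s t hr.1 hr.2 hst htT).trans_eq (by ring))
        refine this.trans ?_
        have e4 := hpow s hs (hst.trans htT)
        calc _ ≤ C * Λ * (t - s) ^ β * (Real.exp (ρ * t) * ρ ^ (-θ)) *
              (B₂ * (T * s ^ (-β))) := by gcongr
          _ = _ := by ring
      rw [e1]
      refine (norm_add_le _ _).trans ((add_le_add e2 e3).trans_eq ?_)
      ring
    · have hs0 := Real.rpow_nonneg hs.le (-β)
      have hhβ := Real.rpow_nonneg hh β
      have hi := hint s hs hsT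
      have hi2 : IntervalIntegrable (fun r => S h (mildIntegrand S α ω f H s r)) volume 0 s :=
        ⟨(S h).integrable_comp hi.1, (S h).integrable_comp hi.2⟩
      have e1 : S h (mildIntegral S α ω f H s) - mildIntegral S α ω f H s = ∫ r in (0 : ℝ)..s,
          (S h (mildIntegrand S α ω f H s r) - mildIntegrand S α ω f H s r) := by
        rw [intervalIntegral.integral_sub hi2 hi, (S h).intervalIntegral_comp_comm hi]
        rfl
      have := norm_integral_le_of_weight (g := fun r => S h (mildIntegrand S α ω f H s r) -
        mildIntegrand S α ω f H s r) (a := -β)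
        (b := 2 * θ - 1) (θ := θ) (ρ := ρ) (K := C * Λ * h ^ β) hs hρ hθ0.le (by linarith)
        (by linarith) (by linarith) (by positivity) (fun r hr =>
          (h3 r s h hr.1 hr.2 hsT hh).trans_eq (by ring))
      rw [e1]
      refine this.trans ?_
      have e4 := hpow s hs hsT
      calc _ ≤ C * Λ * h ^ β * (Real.exp (ρ * s) * ρ ^ (-θ)) * (B₂ * (T * s ^ (-β))) := by gcongr
        _ = _ := by ring
  refine ⟨C * B₁ + C * (T / (β + θ)) + 2 * (C * B₂ * T), by positivity,
    fun ρ Λ f H hρ hK => ?_⟩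
  obtain ⟨m1, m2, m3⟩ := main ρ Λ f H hρ hK
  have hΛ := hK.nonneg
  have p1 : 0 ≤ C * B₁ := by positivity
  have p2 : 0 ≤ C * B₂ * T := by positivity
  have hρθ := Real.rpow_nonneg hρ.le (-θ)
  refine ⟨fun t ht => (m1 t ht).trans ?_, fun s t hs hst htT => ?_, fun s h hs hsT hh =>
    (m3 s h hs hsT hh).trans ?_⟩
  · have := Real.rpow_nonneg ht.1.le θ
    gcongr
    linarith
  · have hs0 := Real.rpow_nonneg hs.le (-β)
    have hts : 0 ≤ t - s := sub_nonneg.2 hst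
    have htsβ := Real.rpow_nonneg hts β
    have n2 := m2 s t hs hst htT
    have n3 := m3 s (t - s) hs (hst.trans htT) hts
    have n4 : ‖S (t - s) (mildIntegral S α ω f H s) - mildIntegral S α ω f H s‖ ≤
        (C * B₂ * T) * (Λ * (Real.exp (ρ * t) * ρ ^ (-θ))) * (s ^ (-β) * (t - s) ^ β) := by
      refine n3.trans ?_
      gcongr
    have := norm_add_le_of_le n2 n4
    rw [sub_add_sub_cancel] at this
    refine this.trans ?_
    rw [← add_mul, ← add_mul]
    refine mul_le_mul_of_nonneg_right (mul_le_mul_of_nonneg_right ?_ (by positivity))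
      (by positivity)
    linarith
  · have hs0 := Real.rpow_nonneg hs.le (-β)
    have hhβ := Real.rpow_nonneg hh β
    gcongr
    linarith

/-- With common bounds, pointwise convergence of the coefficients suffices: dominated convergence is
used inside the fractional derivative and again in the outer integral. -/
theorem tendsto_mildIntegral (hS : SmoothingSemigroup S) (hE : Exponents α β β' γ θ)
    (hT : 1 ≤ T) (hω : HolderPath β' M T ω) (hρ : 0 ≤ ρ) {f : ℕ → ℝ → V} {f₀ : ℝ → V}
    {H : ℕ → ℝ → V →L[ℝ] V} {H₀ : ℝ → V →L[ℝ] V} (hK : ∀ n, KernelAdm β ρ Λ T (f n) (H n))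
    (hf : ∀ r ∈ Ioc 0 T, Tendsto (fun n => f n r) atTop (𝓝 (f₀ r)))
    (hH : ∀ r ∈ Ioc 0 T, Tendsto (fun n => H n r) atTop (𝓝 (H₀ r))) {t : ℝ} (ht : t ∈ Ioc 0 T) :
    Tendsto (fun n => mildIntegral S α ω (f n) (H n) t) atTop
      (𝓝 (mildIntegral S α ω f₀ H₀ t)) := by
  obtain ⟨C, -, hC⟩ := exists_norm_mildIntegrand_le hS hE hT hω hρ Λ
  obtain ⟨hα, hα', hαγ, hγβ, hββ', hβ', hθ, hθ0⟩ := hE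
  refine intervalIntegral.tendsto_integral_filter_of_dominated_convergence
    (fun r => C * (r ^ (-β) * (t - r) ^ (β - 1 + 2 * θ))) (Eventually.of_forall fun n => ?_)
    (Eventually.of_forall fun n => ?_)
    ((intervalIntegrable_rpow_mul_sub_rpow (by linarith) (by linarith) ht.1).const_mul C) ?_
  · rw [uIoc_of_le ht.1.le, ← Measure.restrict_congr_set Ioo_ae_eq_Ioc]
    exact aestronglyMeasurable_mildIntegrand hS (hK n) hω.cont ht.2
  · filter_upwards [ae_mem_Ioo_of_mem_Ioc 0 t] with r hr hrt
    rw [uIoc_of_le ht.1.le] at hrt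
    have hr := hr hrt
    exact hC _ _ (hK n) r t hr.1 hr.2 ht.2
  · filter_upwards [ae_mem_Ioo_of_mem_Ioc 0 t] with r hr hrt
    rw [uIoc_of_le ht.1.le] at hrt
    have hr := hr hrt
    have hrT : r ∈ Ioc 0 T := ⟨hr.1, hr.2.le.trans ht.2⟩
    refine (((S (t - r)).continuous.tendsto _).comp (hf r hrT)).sub ?_
    have h1 : Tendsto (fun n => convFrac S α (H n) t r) atTop (𝓝 (convFrac S α H₀ t r)) := by
      refine tendsto_leftFrac (fun n => leftAdm_semigroup hS (hK n).weight hr.1 hr.2 ht.2 hT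
        (hα.trans hαγ).le hγβ (by linarith)) hr.1 hαγ (by linarith) fun q hq => ?_
      exact ((ContinuousLinearMap.compL ℝ V V V (S (t - q))).continuous.tendsto _).comp
        (hH q ⟨hq.1, hq.2.trans hrT.2⟩)
    exact (isBoundedBilinearMap_apply.continuous.tendsto
      (convFrac S α H₀ t r, rightFrac α t ω r)).comp (h1.prodMk_nhds tendsto_const_nhds)

end Estimates

/-! ### Coefficient bounds and the a priori estimate for mild solutions -/

section APriori

variable {V : Type*} [NormedAddCommGroup V] [InnerProductSpace ℝ V]

/-- Parseval applied to the adjoint gives `‖B* y‖² = ∑ ⟪B (e i), y⟫²`, which Cauchy–Schwarz bounds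
term by term. -/
theorem norm_le_of_hilbertSchmidtENorm_le [CompleteSpace V] {ι : Type*} (e : HilbertBasis ι ℝ V)
    {B : V →L[ℝ] V} {c : ℝ} (hc : 0 ≤ c) (h : hilbertSchmidtENorm e B ≤ ENNReal.ofReal c) :
    ‖B‖ ≤ c := by
  have h1 : ∑' i, ‖B (e i)‖ₑ ^ 2 ≤ ENNReal.ofReal (c ^ 2) := by
    have := ENNReal.rpow_le_rpow h (zero_le_two (α := ℝ))
    rw [hilbertSchmidtENorm, ← ENNReal.rpow_mul, one_div, inv_mul_cancel₀ two_ne_zero,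
      ENNReal.rpow_one, ENNReal.rpow_ofNat, ← ENNReal.ofReal_pow hc] at this
    exact this
  have h2 : ∀ s : Finset ι, ∑ i ∈ s, ‖B (e i)‖ ^ 2 ≤ c ^ 2 := by
    intro s
    have h3 : ∑ i ∈ s, ‖B (e i)‖ₑ ^ 2 = ENNReal.ofReal (∑ i ∈ s, ‖B (e i)‖ ^ 2) := by
      rw [ENNReal.ofReal_sum_of_nonneg fun i _ => by positivity]
      refine Finset.sum_congr rfl fun i _ => ?_
      rw [ENNReal.ofReal_pow (norm_nonneg _), ofReal_norm]
    have h4 := (ENNReal.sum_le_tsum s).trans h1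
    rw [h3] at h4
    exact (ENNReal.ofReal_le_ofReal_iff (by positivity)).1 h4
  rw [← LinearIsometryEquiv.norm_map ContinuousLinearMap.adjoint B]
  refine ContinuousLinearMap.opNorm_le_bound _ hc fun y => ?_
  have h5 := e.hasSum_inner_mul_inner (B.adjoint y) (B.adjoint y)
  have h6 : ⟪B.adjoint y, B.adjoint y⟫ ≤ c ^ 2 * ‖y‖ ^ 2 := by
    refine hasSum_le_of_sum_le h5 fun s => ?_
    calc _ ≤ ∑ i ∈ s, ‖B (e i)‖ ^ 2 * ‖y‖ ^ 2 := by
          refine Finset.sum_le_sum fun i _ => ?_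
          rw [real_inner_comm, ContinuousLinearMap.adjoint_inner_right, ← sq, ← mul_pow,
            real_inner_comm, ← sq_abs]
          have := abs_real_inner_le_norm (B (e i)) y
          rw [real_inner_comm]
          gcongr
      _ ≤ _ := by
          rw [← Finset.sum_mul]
          gcongr
          exact h2 s
  rw [real_inner_self_eq_norm_sq, ← mul_pow] at h6
  exact abs_le_of_sq_le_sq' h6 (by positivity) |>.2

/-- Growth and Lipschitz bounds for the coefficients. -/
structure CoeffBounds (F : V → V) (G : V → V →L[ℝ] V) (c₀ c₁ : ℝ) : Prop where
  nonneg₀ : 0 ≤ c₀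
  nonneg₁ : 0 ≤ c₁
  F_cont : Continuous F
  F_growth : ∀ u, ‖F u‖ ≤ c₀ + c₁ * ‖u‖
  G_growth : ∀ u, ‖G u‖ ≤ c₀ + c₁ * ‖u‖
  G_lip : ∀ u v, ‖G u - G v‖ ≤ c₁ * ‖u - v‖

theorem exists_coeffBounds [CompleteSpace V] {ι : Type*} (e : HilbertBasis ι ℝ V) {F : V → V}
    {G : V → V →L[ℝ] V} (hF : Continuous F) (hFg : ∃ c L : ℝ, ∀ u : V, ‖F u‖ ≤ c + L * ‖u‖)
    (hG : IsLipschitzHilbertSchmidt e G) : ∃ c₀ c₁, CoeffBounds F G c₀ c₁ := by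
  obtain ⟨c, L, hcL⟩ := hFg
  obtain ⟨-, K, hK⟩ := hG
  have hlip : ∀ u v, ‖G u - G v‖ ≤ |K| * ‖u - v‖ := fun u v =>
    norm_le_of_hilbertSchmidtENorm_le e (by positivity)
      ((hK u v).trans (ENNReal.ofReal_le_ofReal (by gcongr; exact le_abs_self K)))
  refine ⟨|c| + ‖G 0‖, |L| + |K|, by positivity, by positivity, hF, fun u => ?_, fun u => ?_,
    fun u v => ?_⟩
  · have h1 : L * ‖u‖ ≤ |L| * ‖u‖ := by gcongr; exact le_abs_self L
    have h2 : 0 ≤ |K| * ‖u‖ := by positivity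
    have h3 := le_abs_self c
    have h4 := norm_nonneg (G 0)
    linarith [hcL u]
  · have h1 := hlip u 0
    rw [sub_zero] at h1
    have h2 : ‖G u‖ ≤ ‖G u - G 0‖ + ‖G 0‖ := by simpa using norm_add_le (G u - G 0) (G 0)
    have h3 := abs_nonneg c
    have h4 : 0 ≤ |L| * ‖u‖ := by positivity
    linarith
  · have h4 : 0 ≤ |L| * ‖u - v‖ := by positivity
    linarith [hlip u v]

variable {S : ℝ → V →L[ℝ] V} {α β β' γ θ ρ T M N c₀ c₁ : ℝ} {ω : ℝ → V} {F : V → V}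
  {G : V → V →L[ℝ] V} {u : ℝ → V}

theorem CoeffBounds.G_cont (h : CoeffBounds F G c₀ c₁) : Continuous G := by
  have : LipschitzWith ⟨c₁, h.nonneg₁⟩ G := LipschitzWith.of_dist_le_mul fun x y => by
    rw [dist_eq_norm, dist_eq_norm]
    exact h.G_lip x y
  exact this.continuous

theorem CoeffBounds.kernelAdm (h : CoeffBounds F G c₀ c₁) (hρ : 0 ≤ ρ)
    (hu : WeightAdm β ρ N T u) :
    KernelAdm β ρ (c₀ + c₁ * N) T (fun r => F (u r)) (fun r => G (u r)) := by
  have h0 := h.nonneg₀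
  have h1 := h.nonneg₁
  have hN := hu.nonneg
  have hgr : ∀ r ∈ Ioc 0 T, c₀ + c₁ * ‖u r‖ ≤ (c₀ + c₁ * N) * Real.exp (ρ * r) := by
    intro r hr
    have h2 : 1 ≤ Real.exp (ρ * r) := Real.one_le_exp (mul_nonneg hρ hr.1.le)
    have h3 := mul_le_mul_of_nonneg_left (hu.bound r hr) h1
    have h4 := le_mul_of_one_le_right h0 h2
    linarith
  refine ⟨h.F_cont.comp_continuousOn hu.cont, fun r hr => (h.F_growth _).trans (hgr r hr),
    by positivity, h.G_cont.comp_continuousOn hu.cont, fun r hr => (h.G_growth _).trans (hgr r hr),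
    fun q r hq hqr hrT => ?_⟩
  have hqβ := Real.rpow_nonneg hq.le (-β)
  have hrq := Real.rpow_nonneg (sub_pos.2 hqr).le β
  calc _ ≤ c₁ * (N * Real.exp (ρ * r) * q ^ (-β) * (r - q) ^ β) :=
        (h.G_lip _ _).trans (mul_le_mul_of_nonneg_left (hu.holder q r hq hqr hrT) h1)
    _ = (c₁ * N) * Real.exp (ρ * r) * q ^ (-β) * (r - q) ^ β := by ring
    _ ≤ _ := by
        gcongr
        linarith

theorem exists_weightAdm (hu : MemWeightedHolder β 0 T u) (hρ : 0 ≤ ρ) :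
    ∃ N, WeightAdm β ρ N T u := by
  obtain ⟨hc, hfin⟩ := hu
  set N := (weightedHolderENorm β 0 T u).toReal with hN
  have hN0 : 0 ≤ N := ENNReal.toReal_nonneg
  refine ⟨N, hN0, hc.mono Ioc_subset_Icc_self, fun r hr => ?_, fun q r hq hqr hrT => ?_⟩
  · have h1 : ‖u r‖ₑ ≤ weightedHolderENorm β 0 T u :=
      le_trans (le_iSup₂ (f := fun s (_ : s ∈ Icc 0 T) => ‖u s‖ₑ) r ⟨hr.1.le, hr.2⟩) le_self_add
    have h2 : ‖u r‖ ≤ N := by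
      rw [← toReal_enorm]
      exact ENNReal.toReal_mono hfin.ne h1
    exact h2.trans (le_mul_of_one_le_right hN0 (Real.one_le_exp (mul_nonneg hρ hr.1.le)))
  · have h1 : ENNReal.ofReal ((q - 0) ^ β * (‖u r - u q‖ / (r - q) ^ β)) ≤
        weightedHolderENorm β 0 T u :=
      le_trans (le_iSup₂_of_le (f := fun s t => ⨆ (_ : 0 < s ∧ s < t ∧ t ≤ T),
        ENNReal.ofReal ((s - 0) ^ β * (‖u t - u s‖ / (t - s) ^ β))) q r
        (le_iSup_of_le ⟨hq, hqr, hrT⟩ le_rfl)) le_add_self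
    have h2 := ENNReal.toReal_mono hfin.ne h1
    have hrq : 0 < r - q := sub_pos.2 hqr
    have hrq' := Real.rpow_pos_of_pos hrq β
    have hq' := Real.rpow_pos_of_pos hq β
    rw [sub_zero, ENNReal.toReal_ofReal (by positivity), ← hN] at h2
    have h3 : ‖u r - u q‖ ≤ N * q ^ (-β) * (r - q) ^ β := by
      rw [Real.rpow_neg hq.le, ← div_le_iff₀ hrq', ← div_eq_mul_inv, le_div_iff₀ hq', mul_comm]
      exact h2
    refine h3.trans ?_
    have := le_mul_of_one_le_right hN0 (Real.one_le_exp (mul_nonneg hρ (hq.trans hqr).le))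
    gcongr

theorem memWeightedHolder_of_weightAdm (hu : WeightAdm β ρ N T u) (hρ : 0 ≤ ρ)
    (hc : ContinuousOn u (Icc 0 T)) : MemWeightedHolder β 0 T u := by
  refine ⟨hc, ?_⟩
  have hN := hu.nonneg
  have he : ∀ r, r ≤ T → N * Real.exp (ρ * r) ≤ N * Real.exp (ρ * T) := fun r hr => by gcongr
  have h1 : (⨆ s ∈ Icc 0 T, ‖u s‖ₑ) ≤ ENNReal.ofReal (N * Real.exp (ρ * T) + ‖u 0‖) := by
    refine iSup₂_le fun s hs => ?_
    rw [← ofReal_norm]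
    refine ENNReal.ofReal_le_ofReal ?_
    have h0 : 0 ≤ N * Real.exp (ρ * T) := by positivity
    rcases hs.1.eq_or_lt with rfl | h
    · linarith
    · linarith [hu.bound s ⟨h, hs.2⟩, he s hs.2, norm_nonneg (u 0)]
  have h2 : (⨆ (s : ℝ) (t : ℝ) (_ : 0 < s ∧ s < t ∧ t ≤ T),
      ENNReal.ofReal ((s - 0) ^ β * (‖u t - u s‖ / (t - s) ^ β))) ≤
      ENNReal.ofReal (N * Real.exp (ρ * T)) := by
    refine iSup_le fun s => iSup_le fun t => iSup_le fun h => ENNReal.ofReal_le_ofReal ?_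
    have hts := Real.rpow_pos_of_pos (sub_pos.2 h.2.1) β
    have hs := Real.rpow_pos_of_pos h.1 β
    have h3 := hu.holder s t h.1 h.2.1 h.2.2
    rw [sub_zero, mul_comm, ← le_div_iff₀ hs, div_le_iff₀ hts]
    refine h3.trans ?_
    rw [Real.rpow_neg h.1.le, ← div_eq_mul_inv]
    gcongr
    exact h.2.2
  exact (add_le_add h1 h2).trans_lt (ENNReal.add_lt_top.2
    ⟨ENNReal.ofReal_lt_top, ENNReal.ofReal_lt_top⟩)

variable [CompleteSpace V]

theorem eq_mildIntegral_iff {ι : Type*} [Countable ι] (e : HilbertBasis ι ℝ V)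
    (hS : SmoothingSemigroup S) (hE : Exponents α β β' γ θ) (hT : 1 ≤ T)
    (hω : HolderPath β' M T ω) (hFG : CoeffBounds F G c₀ c₁) (hρ : 0 ≤ ρ)
    (hu : WeightAdm β ρ N T u) {t : ℝ} (ht : t ∈ Ioc 0 T) (u₀ : V) :
    S t u₀ + (∫ r in (0 : ℝ)..t, S (t - r) (F (u r))) +
        pathwiseIntegral e α 0 t (fun r => (S (t - r)).comp (G (u r))) ω =
      S t u₀ + mildIntegral S α ω (fun r => F (u r)) (fun r => G (u r)) t := by
  have hK := hFG.kernelAdm hρ hu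
  rw [pathwiseIntegral_eq e hS hE hT hω hρ hK ht.1 ht.2, mildIntegral,
    integral_mildIntegrand hS hE hT hω hρ hK ht.1 ht.2]
  abel

theorem SmoothingSemigroup.norm_apply_sub_le (hS : SmoothingSemigroup S) {s t : ℝ} (hs : 0 < s)
    (hst : s ≤ t) (hβ : 0 ≤ β) (hβ1 : β ≤ 1) (x : V) :
    ‖S t x - S s x‖ ≤ ‖x‖ * (s ^ (-β) * (t - s) ^ β) := by
  have h := (S t - S s).le_of_opNorm_le (hS.holder s t β hs hst hβ hβ1) x
  rw [Real.div_rpow (sub_nonneg.2 hst) hs.le, div_eq_mul_inv, ← Real.rpow_neg hs.le] at h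
  exact h.trans_eq (by ring)

/-- Any finite weighted bound `N` may be replaced by an affine expression in `N` of slope `1/2`,
because linear growth of `F`, `G` and the Lipschitz bound on `G` make the coefficients' norm affine
in `N`. -/
theorem exists_improvement (hS : SmoothingSemigroup S) (hE : Exponents α β β' γ θ) (hT : 1 ≤ T)
    (hω : HolderPath β' M T ω) (hFG : CoeffBounds F G c₀ c₁) :
    ∃ ρ K, 0 < ρ ∧ 0 ≤ K ∧ ∀ (u₀ : V) (u : ℝ → V) (N : ℝ), WeightAdm β ρ N T u →
      (∀ t ∈ Ioc 0 T,
        u t = S t u₀ + mildIntegral S α ω (fun r => F (u r)) (fun r => G (u r)) t) →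
      WeightAdm β ρ (‖u₀‖ + K + N / 2) T u := by
  obtain ⟨C, hC, hB⟩ := exists_mildIntegral_bounds hS hE hT hω
  obtain ⟨hα, hα', hαγ, hγβ, hββ', hβ', hθ, hθ0⟩ := hE
  have h0 := hFG.nonneg₀
  have h1 := hFG.nonneg₁
  have hT0 : 0 < T := by linarith
  -- Large `ρ` makes the coefficient of `N` less than `1/2`; `ρ ≥ 1` keeps the constant part below
  -- `C * T * c₀`.
  have hlim : Tendsto (fun ρ : ℝ => C * T * c₁ * ρ ^ (-θ)) atTop (𝓝 (C * T * c₁ * 0)) :=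
    (tendsto_rpow_neg_atTop hθ0).const_mul _
  rw [mul_zero] at hlim
  obtain ⟨ρ, hρs, hρ1⟩ := ((hlim.eventually (gt_mem_nhds (by norm_num : (0 : ℝ) < 1 / 2))).and
    (eventually_ge_atTop 1)).exists
  have hρ : 0 < ρ := by linarith
  have hρθ : ρ ^ (-θ) ≤ 1 := Real.rpow_le_one_of_one_le_of_nonpos hρ1 (by linarith)
  have hρθ0 := Real.rpow_nonneg hρ.le (-θ)
  refine ⟨ρ, C * T * c₀, hρ, by positivity, fun u₀ u N hu heq => ?_⟩
  obtain ⟨b1, b2, -⟩ := hB ρ _ _ _ hρ (hFG.kernelAdm hρ.le hu)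
  have hN := hu.nonneg
  have hconst : C * T * (c₀ + c₁ * N) * ρ ^ (-θ) ≤ C * T * c₀ + N / 2 := by
    have e1 : C * T * c₀ * ρ ^ (-θ) ≤ C * T * c₀ := mul_le_of_le_one_right (by positivity) hρθ
    have e2 := mul_le_mul_of_nonneg_right hρs.le hN
    calc _ = C * T * c₀ * ρ ^ (-θ) + C * T * c₁ * ρ ^ (-θ) * N := by ring
      _ ≤ _ := by linarith
  refine ⟨by positivity, hu.cont, fun t ht => ?_, fun s t hs hst htT => ?_⟩
  · have hexp : 1 ≤ Real.exp (ρ * t) := Real.one_le_exp (mul_nonneg hρ.le ht.1.le)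
    rw [heq t ht]
    have e1 : ‖S t u₀‖ ≤ ‖u₀‖ * Real.exp (ρ * t) :=
      (hS.norm_apply_le ht.1.le _).trans (le_mul_of_one_le_right (norm_nonneg _) hexp)
    have e2 : ‖mildIntegral S α ω (fun r => F (u r)) (fun r => G (u r)) t‖ ≤
        (C * T * c₀ + N / 2) * Real.exp (ρ * t) := by
      have := rpow_le_self_of_one_le ht.1.le ht.2 hT hθ0.le (by linarith)
      calc _ ≤ C * ((c₀ + c₁ * N) * (Real.exp (ρ * t) * ρ ^ (-θ))) * t ^ θ := b1 t ht
        _ ≤ C * ((c₀ + c₁ * N) * (Real.exp (ρ * t) * ρ ^ (-θ))) * T := by gcongr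
        _ = (C * T * (c₀ + c₁ * N) * ρ ^ (-θ)) * Real.exp (ρ * t) := by ring
        _ ≤ _ := by gcongr
    exact (norm_add_le_of_le e1 e2).trans_eq (by ring)
  · have hs' := Real.rpow_nonneg hs.le (-β)
    have hts := Real.rpow_nonneg (sub_pos.2 hst).le β
    have hexp : 1 ≤ Real.exp (ρ * t) := Real.one_le_exp (mul_nonneg hρ.le (hs.trans hst).le)
    rw [heq t ⟨hs.trans hst, htT⟩, heq s ⟨hs, hst.le.trans htT⟩, add_sub_add_comm]
    have e1 : ‖S t u₀ - S s u₀‖ ≤ ‖u₀‖ * Real.exp (ρ * t) * (s ^ (-β) * (t - s) ^ β) := by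
      refine (hS.norm_apply_sub_le (β := β) hs hst.le (by linarith) (by linarith) u₀).trans ?_
      exact mul_le_mul_of_nonneg_right (le_mul_of_one_le_right (norm_nonneg _) hexp)
        (mul_nonneg hs' hts)
    have e2 := b2 s t hs hst.le htT
    have e3 : C * ((c₀ + c₁ * N) * (Real.exp (ρ * t) * ρ ^ (-θ))) * (s ^ (-β) * (t - s) ^ β) ≤
        (C * T * c₀ + N / 2) * Real.exp (ρ * t) * (s ^ (-β) * (t - s) ^ β) := by
      have e4 : C * (c₀ + c₁ * N) * ρ ^ (-θ) ≤ C * T * c₀ + N / 2 := by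
        refine le_trans ?_ hconst
        have : C ≤ C * T := le_mul_of_one_le_right hC hT
        gcongr
      calc _ = (C * (c₀ + c₁ * N) * ρ ^ (-θ)) * Real.exp (ρ * t) * (s ^ (-β) * (t - s) ^ β) := by
            ring
        _ ≤ _ := by gcongr
    exact (norm_add_le_of_le e1 (e2.trans e3)).trans_eq (by ring)

theorem WeightAdm.of_tendsto {E : Type*} [NormedAddCommGroup E] {v : ℝ → E} {n : ℕ → ℝ} {m : ℝ}
    (h : ∀ k, WeightAdm β ρ (n k) T v) (hn : Tendsto n atTop (𝓝 m)) : WeightAdm β ρ m T v := by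
  refine ⟨ge_of_tendsto' hn fun k => (h k).nonneg, (h 0).cont,
    fun r hr => ge_of_tendsto' (hn.mul_const _) fun k => (h k).bound r hr,
    fun q r hq hqr hr => ?_⟩
  exact ge_of_tendsto' (((hn.mul_const _).mul_const _).mul_const _)
    fun k => (h k).holder q r hq hqr hr

/-- The a priori estimate: mild solutions are bounded in the weighted Hölder space by a constant
that depends on the initial value only through its norm. -/
theorem exists_apriori_bound {ι : Type*} [Countable ι] (e : HilbertBasis ι ℝ V)
    (hS : SmoothingSemigroup S) (hE : Exponents α β β' γ θ) (hT : 1 ≤ T)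
    (hω : HolderPath β' M T ω) (hFG : CoeffBounds F G c₀ c₁) (R : ℝ) :
    ∃ ρ N, 0 < ρ ∧ ∀ (u₀ : V) (u : ℝ → V), ‖u₀‖ ≤ R →
      IsMildSolution S e F G α β T ω u₀ u → WeightAdm β ρ N T u ∧ ∀ t ∈ Ioc 0 T,
        u t = S t u₀ + mildIntegral S α ω (fun r => F (u r)) (fun r => G (u r)) t := by
  obtain ⟨ρ, K, hρ, hK, himp⟩ := exists_improvement hS hE hT hω hFG
  refine ⟨ρ, 2 * (R + K), hρ, fun u₀ u hu₀ hu => ?_⟩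
  obtain ⟨N, hN⟩ := exists_weightAdm hu.1 hρ.le
  have heq : ∀ t ∈ Ioc 0 T,
      u t = S t u₀ + mildIntegral S α ω (fun r => F (u r)) (fun r => G (u r)) t := fun t ht => by
    rw [← eq_mildIntegral_iff e hS hE hT hω hFG hρ.le hN ht u₀]
    exact hu.2 t ⟨ht.1.le, ht.2⟩
  refine ⟨?_, heq⟩
  -- The map `N ↦ R + K + N / 2` has fixed point `2 * (R + K)`, and each iteration halves the
  -- distance to it. The solution-dependent starting bound disappears in the limit.
  have hiter : ∀ k : ℕ, WeightAdm β ρ (2 * (R + K) + (1 / 2) ^ k * N) T u := by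
    have hR : 0 ≤ R := (norm_nonneg _).trans hu₀
    have hmono : ∀ {a b : ℝ}, a ≤ b → WeightAdm β ρ a T u → WeightAdm β ρ b T u := by
      intro a b hab h
      refine ⟨h.nonneg.trans hab, h.cont, fun r hr => (h.bound r hr).trans (by gcongr),
        fun q r hq hqr hr => (h.holder q r hq hqr hr).trans ?_⟩
      have := Real.rpow_nonneg hq.le (-β)
      have := Real.rpow_nonneg (sub_pos.2 hqr).le β
      gcongr
    intro k
    induction k with
    | zero => exact hmono (by linarith) hN
    | succ k ih =>
      refine hmono ?_ (himp u₀ u _ ih heq)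
      rw [pow_succ]
      linarith
  refine WeightAdm.of_tendsto hiter ?_
  have h1 : Tendsto (fun k : ℕ => (1 / 2 : ℝ) ^ k) atTop (𝓝 0) :=
    tendsto_pow_atTop_nhds_zero_of_lt_one (by norm_num) (by norm_num)
  simpa using (h1.mul_const N).const_add (2 * (R + K))

end APriori

/-! ### Compactness, limits of solutions and upper semicontinuity -/

section Limits

variable {V : Type*} [NormedAddCommGroup V] [InnerProductSpace ℝ V]

theorem exists_holderPath {β' : ℝ} {ω : ℝ → V} (hω : ω ∈ pathSpace V β') (T : ℝ) :
    ∃ M, HolderPath β' M T ω := by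
  obtain ⟨n, hn⟩ := exists_nat_ge T
  obtain ⟨hc, -, hl⟩ := hω
  obtain ⟨hfin, -⟩ := hl n
  set M := (holderENorm β' (-(n : ℝ)) n ω).toReal with hM
  have hM0 : 0 ≤ M := ENNReal.toReal_nonneg
  refine ⟨M, hc, hM0, fun s t hs hst htT => ?_⟩
  rcases hst.eq_or_lt with rfl | hst
  · rw [sub_self, norm_zero]
    exact mul_nonneg hM0 (Real.rpow_nonneg (sub_self s).ge _)
  have hn0 : (0 : ℝ) ≤ n := n.cast_nonneg
  have h1 : ENNReal.ofReal (‖ω t - ω s‖ / (t - s) ^ β') ≤ holderENorm β' (-(n : ℝ)) n ω :=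
    le_trans (le_iSup₂_of_le (f := fun s t => ⨆ (_ : -(n : ℝ) ≤ s ∧ s < t ∧ t ≤ n),
      ENNReal.ofReal (‖ω t - ω s‖ / (t - s) ^ β')) s t
      (le_iSup_of_le ⟨by linarith, hst, htT.trans hn⟩ le_rfl)) le_add_self
  have hts := Real.rpow_pos_of_pos (sub_pos.2 hst) β'
  have h2 := ENNReal.toReal_mono hfin.ne h1
  rw [ENNReal.toReal_ofReal (by positivity), ← hM, div_le_iff₀ hts, norm_sub_rev] at h2
  exact h2

theorem totallyBounded_of_approx {X : Type*} [PseudoMetricSpace X] {s : Set X}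
    (h : ∀ ε > 0, ∃ K : Set X, TotallyBounded K ∧ ∀ x ∈ s, ∃ y ∈ K, dist x y ≤ ε) :
    TotallyBounded s := by
  rw [Metric.totallyBounded_iff]
  intro ε hε
  obtain ⟨K, hK, hs⟩ := h (ε / 3) (by positivity)
  obtain ⟨F, hF, hKF⟩ := Metric.totallyBounded_iff.1 hK (ε / 3) (by positivity)
  refine ⟨F, hF, fun x hx => ?_⟩
  obtain ⟨y, hy, hxy⟩ := hs x hx
  obtain ⟨z, hz, hyz⟩ := mem_iUnion₂.1 (hKF hy)
  refine mem_iUnion₂.2 ⟨z, hz, ?_⟩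
  rw [Metric.mem_ball] at hyz ⊢
  linarith [dist_triangle x y z]

theorem tendsto_const_mul_rpow_zero {β : ℝ} (hβ : 0 < β) (D t : ℝ) :
    Tendsto (fun s => D * (|s - t|) ^ β) (𝓝 t) (𝓝 0) := by
  have h : Continuous fun s => D * (|s - t|) ^ β :=
    continuous_const.mul (Continuous.rpow_const (by fun_prop) fun _ => Or.inr hβ.le)
  simpa [Real.zero_rpow hβ.ne'] using h.tendsto t

/-- The Hölder bound alone implies continuity away from zero. -/
theorem continuousOn_of_weighted_holder {E : Type*} [NormedAddCommGroup E] {β ρ N T : ℝ}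
    (hβ : 0 < β) (hρ : 0 ≤ ρ) (hN : 0 ≤ N) {v : ℝ → E} (hv : ∀ q r, 0 < q → q < r → r ≤ T →
      ‖v r - v q‖ ≤ N * Real.exp (ρ * r) * q ^ (-β) * (r - q) ^ β) : ContinuousOn v (Ioc 0 T) := by
  intro t ht
  rw [ContinuousWithinAt, tendsto_iff_norm_sub_tendsto_zero]
  have h2 : 0 < t / 2 := half_pos ht.1
  have hb : ∀ᶠ s in 𝓝[Ioc 0 T] t,
      ‖v s - v t‖ ≤ N * Real.exp (ρ * T) * (t / 2) ^ (-β) * (|s - t|) ^ β := by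
    filter_upwards [self_mem_nhdsWithin, mem_nhdsWithin_of_mem_nhds
      (lt_mem_nhds (half_lt_self ht.1))] with s hs hst
    have hst : t / 2 < s := hst
    have hq : ∀ q, t / 2 < q → q ^ (-β) ≤ (t / 2) ^ (-β) := fun q hq =>
      Real.rpow_le_rpow_of_nonpos h2 hq.le (by linarith)
    have he : ∀ r, r ≤ T → Real.exp (ρ * r) ≤ Real.exp (ρ * T) := fun r hr => by gcongr
    rcases lt_trichotomy s t with h | rfl | h
    · rw [norm_sub_rev, abs_sub_comm, abs_of_pos (sub_pos.2 h)]
      have h3 := hq s hst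
      have h4 := he t ht.2
      have h5 := Real.rpow_nonneg hs.1.le (-β)
      have h6 := Real.rpow_nonneg (sub_pos.2 h).le β
      exact (hv s t hs.1 h ht.2).trans (by gcongr)
    · rw [sub_self, norm_zero]
      have := Real.rpow_nonneg h2.le (-β)
      positivity
    · rw [abs_of_pos (sub_pos.2 h)]
      have h3 := hq t (by linarith)
      have h4 := he s hs.2
      have h5 := Real.rpow_nonneg ht.1.le (-β)
      have h6 := Real.rpow_nonneg (sub_pos.2 h).le β
      exact (hv t s ht.1 h hs.2).trans (by gcongr)
  exact squeeze_zero' (Eventually.of_forall fun _ => norm_nonneg _) hb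
    ((tendsto_const_mul_rpow_zero hβ _ t).mono_left nhdsWithin_le_nhds)

/-- Pointwise compactness and local equicontinuity give a subsequence that converges at all positive
times. -/
theorem exists_subseq_tendsto [CompleteSpace V] {β : ℝ} (hβ : 0 < β) {u : ℕ → ℝ → V}
    (hK : ∀ t, 0 < t → ∃ K : Set V, IsCompact K ∧ ∀ n, u n t ∈ K)
    (hW : ∀ T, 1 ≤ T → ∃ ρ N, 0 < ρ ∧ ∀ n, WeightAdm β ρ N T (u n)) :
    ∃ (φ : ℕ → ℕ) (v : ℝ → V), StrictMono φ ∧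
      ∀ t, 0 < t → Tendsto (fun n => u (φ n) t) atTop (𝓝 (v t)) := by
  choose! K hKc hKu using hK
  have hpos : ∀ q : {q : ℚ // 0 < q}, (0 : ℝ) < (q : ℚ) := fun q => by exact_mod_cast q.2
  -- Tychonoff over the countably many positive rationals replaces the diagonal argument.
  have hc : IsCompact (univ.pi fun q : {q : ℚ // 0 < q} => K ((q : ℚ) : ℝ)) :=
    isCompact_univ_pi fun q => hKc _ (hpos q)
  obtain ⟨w, -, φ, hφ, hw⟩ := hc.tendsto_subseq (x := fun n (q : {q : ℚ // 0 < q}) => u n ((q : ℚ) : ℝ))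
    fun n q _ => hKu _ (hpos q) n
  rw [tendsto_pi_nhds] at hw
  have hlim : ∀ t, 0 < t → ∃ x, Tendsto (fun n => u (φ n) t) atTop (𝓝 x) := by
    intro t ht
    refine cauchySeq_tendsto_of_complete (Metric.cauchySeq_iff'.2 fun ε hε => ?_)
    obtain ⟨ρ, N, hρ, hN⟩ := hW (t + 1) (by linarith)
    have hN0 := (hN 0).nonneg
    set D := N * Real.exp (ρ * (t + 1)) * t ^ (-β)
    have hsmall := (tendsto_const_mul_rpow_zero hβ D t).eventually
      (gt_mem_nhds (by positivity : (0 : ℝ) < ε / 4))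
    obtain ⟨δ, hδ, hδs⟩ := Metric.eventually_nhds_iff.1 hsmall
    -- The rational is taken to the right of `t`, so that the singular weight in the Hölder bound is
    -- the fixed number `t ^ (-β)`.
    obtain ⟨q, hq1, hq2⟩ := exists_rat_btwn (show t < min (t + δ) (t + 1) by
      exact lt_min (by linarith) (by linarith))
    have hqδ := hq2.trans_le (min_le_left _ _)
    have hqT := hq2.trans_le (min_le_right _ _)
    have hq0 : (0 : ℚ) < q := by exact_mod_cast ht.trans hq1
    have hclose : ∀ n, dist (u n t) (u n q) ≤ ε / 4 := by
      intro n
      have h1 := (hN n).holder t q ht hq1 hqT.le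
      have h2 := hδs (y := q) (by rw [Real.dist_eq, abs_of_pos] <;> linarith)
      rw [abs_of_pos (sub_pos.2 hq1)] at h2
      rw [dist_comm, dist_eq_norm]
      refine (h1.trans ?_).trans h2.le
      have h5 := Real.rpow_nonneg ht.le (-β)
      have h6 := Real.rpow_nonneg (sub_pos.2 hq1).le β
      simp only [D]
      gcongr
    obtain ⟨n₀, hn₀⟩ := Metric.cauchySeq_iff'.1 ((hw ⟨q, hq0⟩).cauchySeq) (ε / 4) (by positivity)
    refine ⟨n₀, fun n hn => ?_⟩
    have h1 := hclose (φ n)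
    have h2 := hclose (φ n₀)
    have h3 : dist (u (φ n) q) (u (φ n₀) q) < ε / 4 := hn₀ n hn
    have h4 := dist_triangle4 (u (φ n) t) (u (φ n) q) (u (φ n₀) q) (u (φ n₀) t)
    rw [dist_comm (u (φ n₀) q)] at h4
    linarith
  choose! v hv using hlim
  exact ⟨φ, v, hφ, hv⟩

variable {S : ℝ → V →L[ℝ] V} {α β β' γ θ ρ T M N c₀ c₁ : ℝ} {ω : ℝ → V} {F : V → V}
  {G : V → V →L[ℝ] V} {ι : Type*}

theorem pathwiseIntegral_self (e : HilbertBasis ι ℝ V) (α t : ℝ) (g : ℝ → V →L[ℝ] V)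
    (ω : ℝ → V) : pathwiseIntegral e α t t g ω = 0 := by
  simp [pathwiseIntegral]

theorem mild_rhs_zero (hS : SmoothingSemigroup S) (e : HilbertBasis ι ℝ V) (u₀ : V) (u : ℝ → V) :
    S 0 u₀ + (∫ r in (0 : ℝ)..0, S (0 - r) (F (u r))) +
      pathwiseIntegral e α 0 0 (fun r => (S (0 - r)).comp (G (u r))) ω = u₀ := by
  rw [pathwiseIntegral_self, intervalIntegral.integral_same, hS.map_zero]
  simp

variable [CompleteSpace V]

/-- Each value `u t` is within `D h ^ β` of `S h (u t)`, with `D` independent of the solution, and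
`S h` maps the a priori ball to a relatively compact set. Letting `h → 0` gives total boundedness.
-/
theorem exists_compact_values [Countable ι] (e : HilbertBasis ι ℝ V)
    (hS : SmoothingSemigroup S) (hE : Exponents α β β' γ θ) (hT : 1 ≤ T)
    (hω : HolderPath β' M T ω) (hFG : CoeffBounds F G c₀ c₁) (R : ℝ) {t : ℝ} (ht : t ∈ Ioc 0 T) :
    ∃ K : Set V, IsCompact K ∧ ∀ (u₀ : V) (u : ℝ → V), ‖u₀‖ ≤ R →
      IsMildSolution S e F G α β T ω u₀ u → u t ∈ K := by
  obtain ⟨ρ, N, hρ, hap⟩ := exists_apriori_bound e hS hE hT hω hFG R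
  obtain ⟨C, hC, hB⟩ := exists_mildIntegral_bounds hS hE hT hω
  obtain ⟨hα, hα', hαγ, hγβ, hββ', hβ', hθ, hθ0⟩ := hE
  have hβ0 : 0 < β := by linarith
  set A : Set V := {x | ∃ u₀ u, ‖u₀‖ ≤ R ∧ IsMildSolution S e F G α β T ω u₀ u ∧ u t = x} with hA
  suffices h : TotallyBounded A by
    refine ⟨closure A, isCompact_iff_totallyBounded_isComplete.2 ⟨h.closure, isClosed_closure.isComplete⟩,
      fun u₀ u hu₀ hu => subset_closure ⟨u₀, u, hu₀, hu, rfl⟩⟩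
  refine totallyBounded_of_approx fun ε hε => ?_
  set D := t ^ (-β) * R + C * ((c₀ + c₁ * N) * (Real.exp (ρ * t) * ρ ^ (-θ))) * t ^ (-β) with hD
  obtain ⟨h, hh0, hhε⟩ : ∃ h > 0, D * h ^ β < ε := by
    have hsmall := (tendsto_const_mul_rpow_zero hβ0 D 0).eventually (gt_mem_nhds hε)
    obtain ⟨δ, hδ, hδs⟩ := Metric.eventually_nhds_iff.1 hsmall
    refine ⟨δ / 2, by positivity, ?_⟩
    have := hδs (y := δ / 2) (by
      rw [Real.dist_eq, sub_zero, abs_of_pos (by positivity)]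
      linarith)
    rwa [sub_zero, abs_of_pos (by positivity)] at this
  refine ⟨closure (S h '' Metric.closedBall 0 (N * Real.exp (ρ * t))),
    ((hS.compact h hh0).isCompact_closure_image_closedBall _).totallyBounded, ?_⟩
  rintro _ ⟨u₀, u, hu₀, hu, rfl⟩
  obtain ⟨hW, heq⟩ := hap u₀ u hu₀ hu
  refine ⟨S h (u t), subset_closure ⟨u t, by simpa using hW.bound t ht, rfl⟩, ?_⟩
  obtain ⟨-, -, b3⟩ := hB ρ _ _ _ hρ (hFG.kernelAdm hρ.le hW)
  have h3 := b3 t h ht.1 ht.2 hh0.le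
  have hh' := Real.rpow_nonneg hh0.le β
  have h4 : ‖S h (S t u₀) - S t u₀‖ ≤ t ^ (-β) * R * h ^ β := by
    have := ((S h - ContinuousLinearMap.id ℝ V).comp (S t)).le_of_opNorm_le_of_le
      (hS.norm_increment_le (a := β) hh0.le ht.1 hβ0.le (by linarith)) hu₀
    simp only [ContinuousLinearMap.comp_apply, _root_.sub_apply,
      ContinuousLinearMap.id_apply] at this
    exact this.trans_eq (by ring)
  rw [dist_comm, dist_eq_norm, heq t ht, map_add, add_sub_add_comm]
  refine (norm_add_le_of_le h4 h3).trans (le_trans (le_of_eq ?_) hhε.le)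
  rw [hD]
  ring

/-- Limits of mild solutions are mild solutions. -/
theorem isMildSolution_of_tendsto [Countable ι] (e : HilbertBasis ι ℝ V)
    (hS : SmoothingSemigroup S) (hE : Exponents α β β' γ θ) (hT : 1 ≤ T)
    (hω : HolderPath β' M T ω) (hFG : CoeffBounds F G c₀ c₁) {y : ℕ → V} {x₀ : V}
    (hy : Tendsto y atTop (𝓝 x₀)) {u : ℕ → ℝ → V} {v : ℝ → V}
    (hu : ∀ n, IsMildSolution S e F G α β T ω (y n) (u n)) (hv0 : v 0 = x₀)
    (hv : ∀ t ∈ Ioc 0 T, Tendsto (fun n => u n t) atTop (𝓝 (v t))) {T' : ℝ} (hT' : T' ≤ T) :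
    IsMildSolution S e F G α β T' ω x₀ v := by
  obtain ⟨R, hR⟩ := hy.norm.bddAbove_range
  obtain ⟨ρ, N, hρ, hap⟩ := exists_apriori_bound e hS hE hT hω hFG R
  have hap' := fun n => hap (y n) (u n) (hR ⟨n, rfl⟩) (hu n)
  have hβ0 : 0 < β := by linarith [hE.α_pos, hE.α_lt, hE.γ_le]
  have hN := (hap' 0).1.nonneg
  have hhol : ∀ q r, 0 < q → q < r → r ≤ T →
      ‖v r - v q‖ ≤ N * Real.exp (ρ * r) * q ^ (-β) * (r - q) ^ β := fun q r hq hqr hr =>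
    le_of_tendsto' ((hv r ⟨hq.trans hqr, hr⟩).sub (hv q ⟨hq, hqr.le.trans hr⟩)).norm
      fun n => (hap' n).1.holder q r hq hqr hr
  have hW : WeightAdm β ρ N T v :=
    ⟨hN, continuousOn_of_weighted_holder hβ0 hρ.le hN hhol,
      fun r hr => le_of_tendsto' (hv r hr).norm fun n => (hap' n).1.bound r hr, hhol⟩
  have heq : ∀ t ∈ Ioc 0 T,
      v t = S t x₀ + mildIntegral S α ω (fun r => F (v r)) (fun r => G (v r)) t := by
    intro t ht
    refine tendsto_nhds_unique (hv t ht) ?_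
    simp_rw [fun n => (hap' n).2 t ht]
    refine (((S t).continuous.tendsto _).comp hy).add ?_
    exact tendsto_mildIntegral hS hE hT hω hρ.le (fun n => hFG.kernelAdm hρ.le (hap' n).1)
      (fun r hr => (hFG.F_cont.tendsto _).comp (hv r hr))
      (fun r hr => (hFG.G_cont.tendsto _).comp (hv r hr)) ht
  -- The estimates require a horizon at least `1`, while solutions are demanded on arbitrarily short
  -- intervals; hence the restriction from `T` to `T'`.
  have hW' : WeightAdm β ρ N T' v :=
    ⟨hN, hW.cont.mono (Ioc_subset_Ioc_right hT'), fun r hr => hW.bound r ⟨hr.1, hr.2.trans hT'⟩,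
      fun q r hq hqr hr => hW.holder q r hq hqr (hr.trans hT')⟩
  -- The weighted bounds degenerate at zero. Continuity there comes from strong continuity of `S`
  -- and from the factor `t ^ θ` in the bound for the convolution.
  have hcont : ContinuousOn v (Icc 0 T') := by
    intro t ht
    rcases ht.1.eq_or_lt with rfl | ht0
    · obtain ⟨C, hC, hB⟩ := exists_mildIntegral_bounds hS hE hT hω
      obtain ⟨b1, -, -⟩ := hB ρ _ _ _ hρ (hFG.kernelAdm hρ.le hW)
      have hΛ := (hFG.kernelAdm hρ.le hW).nonneg
      have hρθ := Real.rpow_nonneg hρ.le (-θ)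
      have h1 : Tendsto (fun t => ‖S t x₀ - x₀‖) (𝓝[Icc 0 T'] 0) (𝓝 0) := by
        rw [← tendsto_iff_norm_sub_tendsto_zero]
        have := hS.strongly_continuous x₀ 0 self_mem_Ici
        rw [ContinuousWithinAt, hS.map_zero] at this
        exact this.mono_left (nhdsWithin_mono _ Icc_subset_Ici_self)
      have h2 := h1.add ((tendsto_const_mul_rpow_zero hE.θ_pos
        (C * ((c₀ + c₁ * N) * (Real.exp (ρ * T) * ρ ^ (-θ)))) 0).mono_left
        (nhdsWithin_le_nhds (s := Icc 0 T')))
      rw [add_zero] at h2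
      rw [ContinuousWithinAt, tendsto_iff_norm_sub_tendsto_zero, hv0]
      refine squeeze_zero' (Eventually.of_forall fun _ => norm_nonneg _) ?_ h2
      filter_upwards [self_mem_nhdsWithin] with s hs
      rw [sub_zero, abs_of_nonneg hs.1]
      have hsθ := Real.rpow_nonneg hs.1 θ
      rcases hs.1.eq_or_lt with rfl | hs0
      · rw [hv0, sub_self, norm_zero]
        positivity
      · have hsT : s ∈ Ioc 0 T := ⟨hs0, hs.2.trans hT'⟩
        rw [heq s hsT, add_sub_right_comm]
        refine norm_add_le_of_le le_rfl ((b1 s hsT).trans ?_)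
        have := hsT.2
        gcongr
    · have h1 : ContinuousWithinAt v (Ioc 0 T') t := hW'.cont t ⟨ht0, ht.2⟩
      refine h1.mono_of_mem_nhdsWithin ?_
      filter_upwards [self_mem_nhdsWithin, mem_nhdsWithin_of_mem_nhds (lt_mem_nhds ht0)]
        with s hs hs0
      exact ⟨hs0, hs.2⟩
  refine ⟨memWeightedHolder_of_weightAdm hW' hρ.le hcont, fun t ht => ?_⟩
  rcases ht.1.eq_or_lt with rfl | ht0
  · rw [mild_rhs_zero hS, hv0]
  · have htT : t ∈ Ioc 0 T := ⟨ht0, ht.2.trans hT'⟩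
    rw [eq_mildIntegral_iff e hS hE hT hω hFG hρ.le hW htT x₀]
    exact heq t htT

theorem IsMildSolution.apply_zero (hS : SmoothingSemigroup S) {e : HilbertBasis ι ℝ V}
    {u₀ : V} {u : ℝ → V} (hT : 0 ≤ T) (hu : IsMildSolution S e F G α β T ω u₀ u) : u 0 = u₀ := by
  rw [hu.2 0 ⟨le_rfl, hT⟩, mild_rhs_zero hS]

theorem isUpperSemicontinuous_Phi [Countable ι] (e : HilbertBasis ι ℝ V)
    (hS : SmoothingSemigroup S) (hE : Exponents α β β' γ θ) (hFG : CoeffBounds F G c₀ c₁)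
    (hω : ω ∈ pathSpace V β') {t : ℝ} (ht : 0 ≤ t) :
    IsUpperSemicontinuous (fun u₀ : V => Phi S e F G α β t ω u₀) := by
  intro x₀ O hO hsub
  by_contra! hcon
  choose y hy hyO using fun n : ℕ => hcon (1 / ((n : ℝ) + 1)) (by positivity)
  have hex : ∀ n, ∃ u ∈ globalSolutions S e F G α β (y n) ω, u t ∉ O := by
    intro n
    obtain ⟨x, ⟨u, hu, rfl⟩, hx⟩ := not_subset.1 (hyO n)
    exact ⟨u, hu, hx⟩
  choose u hu huO using hex
  have hlim : Tendsto y atTop (𝓝 x₀) := by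
    rw [tendsto_iff_norm_sub_tendsto_zero]
    refine squeeze_zero (fun _ => norm_nonneg _) (fun n => ?_)
      (tendsto_one_div_add_atTop_nhds_zero_nat (𝕜 := ℝ))
    rw [norm_sub_rev]
    exact (hy n).le
  obtain ⟨R, hR⟩ := hlim.norm.bddAbove_range
  have hβ0 : 0 < β := by linarith [hE.α_pos, hE.α_lt, hE.γ_le]
  obtain ⟨φ, v, hφ, hv⟩ := exists_subseq_tendsto hβ0 (u := u)
    (fun s hs => by
      obtain ⟨M, hM⟩ := exists_holderPath hω (max s 1)
      obtain ⟨K, hK, hKu⟩ := exists_compact_values e hS hE (le_max_right s 1) hM hFG R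
        (t := s) ⟨hs, le_max_left s 1⟩
      exact ⟨K, hK, fun n => hKu (y n) (u n) (hR ⟨n, rfl⟩) (hu n _ (lt_max_of_lt_left hs))⟩)
    (fun T hT => by
      obtain ⟨M, hM⟩ := exists_holderPath hω T
      obtain ⟨ρ, N, hρ, hN⟩ := exists_apriori_bound e hS hE hT hM hFG R
      exact ⟨ρ, N, hρ, fun n => (hN (y n) (u n) (hR ⟨n, rfl⟩) (hu n T (by linarith))).1⟩)
  -- The subsequence only determines the limit at positive times, so the initial value is
  -- prescribed. One subsequence serves every horizon, which makes `w` a global solution.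
  set w : ℝ → V := fun s => if 0 < s then v s else x₀ with hw
  have hw0 : w 0 = x₀ := if_neg (lt_irrefl 0)
  have hyφ := hlim.comp hφ.tendsto_atTop
  have hwt : ∀ s, 0 ≤ s → Tendsto (fun n => u (φ n) s) atTop (𝓝 (w s)) := by
    intro s hs
    rcases hs.eq_or_lt with rfl | hs
    · rw [hw0]
      refine hyφ.congr fun n => ?_
      exact ((hu (φ n) 1 one_pos).apply_zero hS zero_le_one).symm
    · rw [hw]
      simp only [if_pos hs]
      exact hv s hs
  have hsol : w ∈ globalSolutions S e F G α β x₀ ω := by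
    intro T hT
    obtain ⟨M, hM⟩ := exists_holderPath hω (max T 1)
    exact isMildSolution_of_tendsto e hS hE (le_max_right T 1) hM hFG hyφ
      (fun n => hu (φ n) _ (lt_max_of_lt_left hT)) hw0 (fun s hs => hwt s hs.1.le)
      (le_max_left T 1)
  have hmem : w t ∈ O := hsub ⟨w, hsol, rfl⟩
  have hout : w t ∈ Oᶜ :=
    hO.isClosed_compl.mem_of_tendsto (hwt t ht) (Eventually.of_forall fun n => huO (φ n))
  exact hout hmem

end Limits

end FractionalEvolution

end

theorem mainTheorem8 {V : Type*} [NormedAddCommGroup V] [InnerProductSpace ℝ V] [CompleteSpace V]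
    [TopologicalSpace.SeparableSpace V]
    (A : V →ₗ.[ℝ] V) (hA : FractionalEvolution.IsAdmissibleOperator A)
    (S : ℝ → V →L[ℝ] V) (hS : FractionalEvolution.IsSemigroupGeneratedBy S A)
    {ι : Type*} (e : HilbertBasis ι ℝ V) (he : FractionalEvolution.IsEigenbasis A e)
    (F : V → V) (hF : Continuous F)
    (hF_growth : ∃ c L : ℝ, ∀ u : V, ‖F u‖ ≤ c + L * ‖u‖)
    (G : V → V →L[ℝ] V) (hG : FractionalEvolution.IsLipschitzHilbertSchmidt e G)
    (α β β' : ℝ) (hβ : 1 / 2 < β) (hββ' : β < β') (hβ' : β' < 1)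
    (hα : 1 - β' < α) (hαβ : α < β)
    (t : ℝ) (ht : 0 ≤ t) (ω : ℝ → V) (hω : ω ∈ FractionalEvolution.pathSpace V β') :
    FractionalEvolution.IsUpperSemicontinuous
      (fun u₀ : V => FractionalEvolution.Phi S e F G α β t ω u₀) := by
  have : Countable ι := FractionalEvolution.countable_of_hilbertBasis e
  obtain ⟨γ, θ, hE⟩ := FractionalEvolution.exists_exponents hββ' hβ' hα hαβ
  obtain ⟨c₀, c₁, hFG⟩ := FractionalEvolution.exists_coeffBounds e hF hF_growth hG
  exact FractionalEvolution.isUpperSemicontinuous_Phi e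
    (FractionalEvolution.smoothingSemigroup hA hS e he) hE hFG hω ht
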